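/- **Conventions.** For a simplicial set $K$ let $\pi K$ be its fundamental groupoid and $N$ the nerve, so that $\pi\dashv N$. Let $\mathcal C$ be a simplicial model category (a model category that is enriched, tensored and cotensored over simplicial sets and satisfies Quillen's axiom SM7) which has small products. Its simplicial structure *derives from an enrichment over groupoids* if $\mathcal C$ is also enriched, tensored and cotensored over the category $\mathrm{Grpd}$ of groupoids and there are natural isomorphisms $\mathrm{sSet}(A,B)\cong N(\mathrm{Grpd}(A,B))$, $A^K\cong A^{\pi K}$, $A\otimes K\cong A\otimes \pi K$ for $A,B\in\mathcal C$ and simplicial sets $K$, compatible with identities, composition and the universal maps of the (co)tensors. For a small category $I$ and an $I$-diagram $X$ with all $X(i)$ fibrant, $\operatorname{holim}_I X$ denotes the equalizer of the two natural maps $$\prod_{i\in I} X(i)^{N(I/i)}\rightrightarrows\prod_{j\to i}X(i)^{N(I/j)} .$$ **Theorem.** (1) Let $\mathcal C$ be a simplicial model category whose simplicial structure derives from an enrichment over groupoids. For a cosimplicial object $X^\bullet$ of $\mathcal C$ let $E(X^\bullet)$ be the equalizer of the natural maps $$\prod_{i=0}^{2}(X^i)^{\Delta^i}\rightrightarrows\prod_{[j]\to[i],\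 i\le 2,\ j\le 1}(X^i)^{\Delta^j}.$$ There is a map $E(X^\bullet)\to\operatorname{holim}_\Delta X^\bullet$, natural in $X^\bullet$, which is a simplicial homotopy equivalence and a weak equivalence whenever every $X^i$ is fibrant. Moreover $E(X^\bullet)$ is naturally isomorphic, over $\prod_{i\le 2}(X^i)^{\Delta^i}$, to $\mathrm{Tot}_2X^\bullet$, the equalizer of $\prod_{i\le 2}(X^i)^{\Delta^i}\rightrightarrows\prod_{[j]\to[i],\ i,j\le 2}(X^i)^{\Delta^j}$. (2) For a cosimplicial groupoid $X^\bullet$ (with $G^K=\mathrm{Fun}(\pi K,G)$ for a groupoid $G$), let $\mathrm{Desc}(X^\bullet)$ be the groupoid whose objects are the pairs $(a,\alpha)$ of an object $a$ of $X^0$ and a morphism $\alpha\colon d^1(a)\to d^0(a)$ of $X^1$ such that $s^0(\alpha)=\mathrm{id}_a$ and $d^0(\alpha)\circ d^2(\alpha)=d^1(\alpha)$, and whose morphisms $(a,\alpha)\to(a',\alpha')$ are the morphisms $\beta\colon a\to a'$ of $X^0$ such that $\alpha'\circ d^1(\beta)=d^0(\beta)\circ\alpha$. Then $\mathrm{Desc}(X^\bullet)$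 is isomorphic, naturally in $X^\bullet$, to the equalizer $E(X^\bullet)$ and to $\mathrm{Tot}_2X^\bullet$, and there is a functor $\mathrm{Desc}(X^\bullet)\to\operatorname{holim}_\Delta X^\bullet$, natural in $X^\bullet$, which is an equivalence of categories. -/

import Mathlib

open CategoryTheory Limits MonoidalCategory CartesianMonoidalCategory Opposite Simplicial
  HomotopicalAlgebra

universe v u v' u'

namespace HolimGrpd

noncomputable section

/-! ### Tensors and cotensors in an enriched category -/

section Cotensor

variable (V : Type u') [Category.{v'} V] [MonoidalCategory V]
  {C : Type u} [Category.{v} C] [EnrichedOrdinaryCategory V C]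

/-- A cotensor `A^K` of `A : C` by `K : V`: an object with a universal morphism
`K ⟶ Hom(A^K, A)`.  The last field says that the induced map `Hom(B, A^K) ⟶ [K, Hom(B, A)]`
is an isomorphism, tested on all generalized elements `L ⟶ Hom(B, A^K)`. -/
structure Cotensor (K : V) (A : C) where
  obj : C
  ev : K ⟶ (obj ⟶[V] A)
  bijective (B : C) (L : V) : Function.Bijective
    (fun f : L ⟶ (B ⟶[V] obj) => ((f ⊗ₘ ev) ≫ eComp V B obj A : L ⊗ K ⟶ (B ⟶[V] A)))

/-- A tensor `A ⊗ K` of `A : C` by `K : V`: an object with a universal morphism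
`K ⟶ Hom(A, A ⊗ K)`, i.e. such that `Hom(A ⊗ K, B) ≅ [K, Hom(A, B)]`. -/
structure Tensor (K : V) (A : C) where
  obj : C
  coev : K ⟶ (A ⟶[V] obj)
  bijective (B : C) (L : V) : Function.Bijective
    (fun f : L ⟶ (obj ⟶[V] B) => ((coev ⊗ₘ f) ≫ eComp V A obj B : K ⊗ L ⟶ (A ⟶[V] B)))

variable (C) in
/-- A `V`-enriched category with tensors and cotensors. -/
class TensoredCotensored where
  tensor (K : V) (A : C) : Tensor V K A
  cotensor (K : V) (A : C) : Cotensor V K A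

variable [TensoredCotensored V C]

/-- The cotensor `A^K`. -/
def pow (K : V) (A : C) : C := (TensoredCotensored.cotensor K A : Cotensor V K A).obj

/-- The universal morphism `K ⟶ Hom(A^K, A)`. -/
def powEv (K : V) (A : C) : K ⟶ (pow V K A ⟶[V] A) :=
  (TensoredCotensored.cotensor K A : Cotensor V K A).ev

/-- The tensor `A ⊗ K`. -/
def ten (K : V) (A : C) : C := (TensoredCotensored.tensor K A : Tensor V K A).obj

/-- The universal morphism `K ⟶ Hom(A, A ⊗ K)`. -/
def tenCoev (K : V) (A : C) : K ⟶ (A ⟶[V] ten V K A) :=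
  (TensoredCotensored.tensor K A : Tensor V K A).coev

variable {V}

lemma pow_bijective (K : V) (A B : C) (L : V) : Function.Bijective
    (fun f : L ⟶ (B ⟶[V] pow V K A) =>
      ((f ⊗ₘ powEv V K A) ≫ eComp V B (pow V K A) A : L ⊗ K ⟶ (B ⟶[V] A))) :=
  (TensoredCotensored.cotensor K A : Cotensor V K A).bijective B L

/-- The morphism `B ⟶ A^K` that corresponds to `φ : K ⟶ Hom(B, A)`. -/
def powLift {K : V} {A B : C} (φ : K ⟶ (B ⟶[V] A)) : B ⟶ pow V K A :=
  (eHomEquiv V).symm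
    ((Equiv.ofBijective _ (pow_bijective K A B (𝟙_ V))).symm ((λ_ K).hom ≫ φ))

lemma powEv_whisker {K : V} {A B : C} (f : B ⟶ pow V K A) :
    powEv V K A ≫ eHomWhiskerRight V f A =
      (λ_ K).inv ≫ (eHomEquiv V f ⊗ₘ powEv V K A) ≫ eComp V B (pow V K A) A := by
  rw [eHomWhiskerRight, leftUnitor_inv_naturality_assoc, tensorHom_def', Category.assoc]

lemma powEv_powLift {K : V} {A B : C} (φ : K ⟶ (B ⟶[V] A)) :
    powEv V K A ≫ eHomWhiskerRight V (powLift φ) A = φ := by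
  rw [powEv_whisker, powLift, Equiv.apply_symm_apply]
  have := (Equiv.ofBijective _ (pow_bijective K A B (𝟙_ V))).apply_symm_apply ((λ_ K).hom ≫ φ)
  rw [Equiv.ofBijective_apply] at this
  rw [this, Iso.inv_hom_id_assoc]

lemma pow_hom_ext {K : V} {A B : C} {f g : B ⟶ pow V K A}
    (h : powEv V K A ≫ eHomWhiskerRight V f A = powEv V K A ≫ eHomWhiskerRight V g A) :
    f = g := by
  rw [powEv_whisker, powEv_whisker] at h
  apply (eHomEquiv V).injective
  apply (pow_bijective K A B (𝟙_ V)).1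
  exact (cancel_epi _).1 h

/-- `A^K ⟶ A'^K'` induced by `K' ⟶ K` and `A ⟶ A'`. -/
def powMap {K K' : V} {A A' : C} (κ : K' ⟶ K) (a : A ⟶ A') : pow V K A ⟶ pow V K' A' :=
  powLift (κ ≫ powEv V K A ≫ eHomWhiskerLeft V _ a)

lemma powEv_powMap {K K' : V} {A A' : C} (κ : K' ⟶ K) (a : A ⟶ A') :
    powEv V K' A' ≫ eHomWhiskerRight V (powMap κ a) A' =
      κ ≫ powEv V K A ≫ eHomWhiskerLeft V _ a := powEv_powLift _

lemma powMap_id (K : V) (A : C) : powMap (𝟙 K) (𝟙 A) = 𝟙 (pow V K A) := by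
  apply pow_hom_ext
  rw [powEv_powMap]
  simp

lemma powMap_comp {K K' K'' : V} {A A' A'' : C} (κ : K' ⟶ K) (κ' : K'' ⟶ K')
    (a : A ⟶ A') (a' : A' ⟶ A'') :
    powMap κ a ≫ powMap κ' a' = powMap (κ' ≫ κ) (a ≫ a') := by
  apply pow_hom_ext
  rw [powEv_powMap, eHomWhiskerRight_comp, ← Category.assoc, powEv_powMap]
  simp only [Category.assoc, eHom_whisker_exchange, eHomWhiskerLeft_comp]
  rw [← Category.assoc (powEv V K' A'), powEv_powMap]
  simp

variable (V C) in
/-- The cotensor bifunctor `(K, A) ↦ A^K`. -/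
def powFunctor : Vᵒᵖ ⥤ C ⥤ C where
  obj K :=
    { obj A := pow V K.unop A
      map a := powMap (𝟙 K.unop) a
      map_id A := powMap_id _ _
      map_comp a a' := by rw [powMap_comp, Category.comp_id] }
  map κ :=
    { app A := powMap κ.unop (𝟙 A)
      naturality A A' a := by simp [powMap_comp] }
  map_id K := by ext A; exact powMap_id _ _
  map_comp κ κ' := by ext A; simp [powMap_comp]

end Cotensor

/-! ### Simplicial model categories -/

section SimplicialModel

variable (C : Type u) [Category.{v} C] [SimplicialCategory C]

open SimplicialCategory

variable {C} in
/-- The map `Hom(B, X) ⟶ Hom(A, X) ×_{Hom(A, Y)} Hom(B, Y)` of simplicial sets. -/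
def pullbackHom {A B X Y : C} (i : A ⟶ B) (p : X ⟶ Y) :
    sHom B X ⟶ pullback (eHomWhiskerLeft SSet.{v} A p) (eHomWhiskerRight SSet.{v} i Y) :=
  pullback.lift (eHomWhiskerRight SSet.{v} i X) (eHomWhiskerLeft SSet.{v} B p)
    (eHom_whisker_exchange SSet.{v} i p).symm

/-- A simplicial model category: a model category which is enriched, tensored and cotensored over
simplicial sets and such that, for a cofibration `i` and a fibration `p`, the map `pullbackHom i p`
is a Kan fibration, and a trivial Kan fibration if moreover `i` or `p` is a weak equivalence. -/
class IsSimplicialModelCategory [ModelCategory C] [TensoredCotensored SSet.{v} C] : Prop where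
  fibration {A B X Y : C} (i : A ⟶ B) (p : X ⟶ Y) [Cofibration i] [Fibration p] :
    SSet.modelCategoryQuillen.J.rlp (pullbackHom i p)
  trivial_left {A B X Y : C} (i : A ⟶ B) (p : X ⟶ Y) [Cofibration i] [Fibration p]
    [WeakEquivalence i] : SSet.modelCategoryQuillen.I.rlp (pullbackHom i p)
  trivial_right {A B X Y : C} (i : A ⟶ B) (p : X ⟶ Y) [Cofibration i] [Fibration p]
    [WeakEquivalence p] : SSet.modelCategoryQuillen.I.rlp (pullbackHom i p)

variable {C}

/-- A simplicial homotopy from `f` to `g`: an edge from `f` to `g` in `Hom(A, B)`. -/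
def SimplicialHomotopic {A B : C} (f g : A ⟶ B) : Prop :=
  ∃ h : sHom A B _⦋1⦌,
    (sHom A B).δ 1 h = homEquiv' A B f ∧ (sHom A B).δ 0 h = homEquiv' A B g

/-- Simplicial homotopy equivalences. -/
def IsSimplicialHomotopyEquiv {A B : C} (f : A ⟶ B) : Prop :=
  ∃ g : B ⟶ A, SimplicialHomotopic (f ≫ g) (𝟙 A) ∧ SimplicialHomotopic (g ≫ f) (𝟙 B)

end SimplicialModel

/-! ### Groupoids -/

section Groupoids

/-- The one-object groupoid with one morphism is terminal. -/
def grpdUnitIsTerminal : IsTerminal (Grpd.of (Discrete PUnit.{v + 1}) : Grpd.{v, v}) :=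
  IsTerminal.ofUniqueHom (fun G => (Functor.const G).obj ⟨PUnit.unit⟩) (fun _ _ => rfl)

/-- The product groupoid. -/
def grpdProdCone (G H : Grpd.{v, v}) : BinaryFan G H :=
  .mk (P := Grpd.of (G × H)) (CategoryTheory.Prod.fst G H) (CategoryTheory.Prod.snd G H)

/-- The product groupoid is a product in the category of groupoids. -/
def grpdProdConeIsLimit (G H : Grpd.{v, v}) : IsLimit (grpdProdCone G H) :=
  BinaryFan.isLimitMk (W := Grpd.of (G × H)) (fst := CategoryTheory.Prod.fst G H)
    (snd := CategoryTheory.Prod.snd G H)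
    (fun s => (Functor.prod' (s.fst : s.pt ⥤ G) (s.snd : s.pt ⥤ H) : s.pt ⥤ G × H))
    (fun _ => rfl) (fun _ => rfl)
    (fun s m h₁ h₂ => by
      rw [← h₁, ← h₂]
      rfl)

instance : CartesianMonoidalCategory Grpd.{v, v} :=
  .ofChosenFiniteProducts ⟨_, grpdUnitIsTerminal⟩
    (fun G H => ⟨grpdProdCone G H, grpdProdConeIsLimit G H⟩)

/-- The nerve of a groupoid. -/
abbrev grpdNerve : Grpd.{v, v} ⥤ SSet.{v} := Grpd.forgetToCat ⋙ nerveFunctor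

/-- The fundamental groupoid of a simplicial set: the groupoid obtained by inverting all morphisms
of the homotopy category, whose objects are the vertices and whose morphisms are generated by the
edges, with a relation for each degenerate edge and each triangle. -/
abbrev fundGrpd : SSet.{v} ⥤ Grpd.{v, v} := SSet.hoFunctor ⋙ Grpd.free

/-- The fundamental groupoid is left adjoint to the nerve. -/
def fundGrpdAdj : fundGrpd.{v} ⊣ grpdNerve.{v} :=
  nerveAdjunction.comp Grpd.freeForgetAdjunction

/-- Functors into a groupoid form a groupoid. -/
instance functorGroupoid (K G : Type v) [Groupoid.{v} K] [Groupoid.{v} G] :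
    Groupoid.{v} (K ⥤ G) where
  inv α :=
    { app k := Groupoid.inv (α.app k)
      naturality k l f := by simp [← cancel_epi (α.app k)] }

/-- The bifunctor `(K, G) ↦ Fun(K, G)` on groupoids. -/
def grpdFun : Grpd.{v, v}ᵒᵖ ⥤ Grpd.{v, v} ⥤ Grpd.{v, v} where
  obj K :=
    { obj G := Grpd.of ((K.unop : Type v) ⥤ G)
      map F := (Functor.whiskeringRight _ _ _).obj F }
  map κ := { app G := (Functor.whiskeringLeft _ _ G).obj κ.unop }

/-- The cotensor `G^K = Fun(π K, G)` of a groupoid `G` by a simplicial set `K`. -/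
def grpdPow : SSet.{v}ᵒᵖ ⥤ Grpd.{v, v} ⥤ Grpd.{v, v} := fundGrpd.op ⋙ grpdFun

instance : HasLimits Grpd.{v, v} := hasLimits_of_reflective Grpd.forgetToCat

instance : HasProducts.{0} Grpd.{v, v} := fun _ => inferInstance

end Groupoids

/-! ### Simplicial structures that derive from an enrichment over groupoids -/

section Derives

open SimplicialCategory

/-- The simplicial structure on `C` derives from the given enrichment over groupoids. -/
structure DerivesFromGrpd (C : Type u) [Category.{v} C]
    [SimplicialCategory C] [TensoredCotensored SSet.{v} C]
    [EnrichedOrdinaryCategory Grpd.{v, v} C] [TensoredCotensored Grpd.{v, v} C] where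
  /-- The simplicial hom is the nerve of the groupoid hom, -/
  homIso (A B : C) : sHom A B ≅ grpdNerve.obj (A ⟶[Grpd.{v, v}] B)
  /-- compatibly with the underlying morphisms of `C` (identities included) -/
  homEquiv_comp {A B : C} (f : A ⟶ B) :
    grpdNerve.map (eHomEquiv Grpd.{v, v} f) ≫ (homIso A B).inv =
      toUnit _ ≫ eHomEquiv SSet.{v} f
  /-- and with composition. -/
  eComp_comp (A B D : C) :
    grpdNerve.map (eComp Grpd.{v, v} A B D) ≫ (homIso A D).inv =
      prodComparison grpdNerve _ _ ≫ ((homIso A B).inv ⊗ₘ (homIso B D).inv) ≫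
        eComp SSet.{v} A B D
  /-- The cotensor `A^K` is the cotensor `A^(π K)`, -/
  powIso (K : SSet.{v}) (A : C) : pow SSet.{v} K A ≅ pow Grpd.{v, v} (fundGrpd.obj K) A
  /-- compatibly with the universal morphisms (hence naturally in `K` and `A`, and compatibly with
  iterated cotensors and `π (K × K') ≅ π K × π K'`). -/
  powEv_comp (K : SSet.{v}) (A : C) :
    powEv SSet.{v} K A ≫ (homIso _ A).hom =
      fundGrpdAdj.unit.app K ≫ grpdNerve.map (powEv Grpd.{v, v} (fundGrpd.obj K) A ≫
        eHomWhiskerRight Grpd.{v, v} (powIso K A).hom A)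
  /-- The tensor `A ⊗ K` is the tensor `A ⊗ π K`, -/
  tenIso (K : SSet.{v}) (A : C) : ten SSet.{v} K A ≅ ten Grpd.{v, v} (fundGrpd.obj K) A
  /-- compatibly with the universal morphisms. -/
  tenCoev_comp (K : SSet.{v}) (A : C) :
    tenCoev SSet.{v} K A ≫ (homIso A _).hom =
      fundGrpdAdj.unit.app K ≫ grpdNerve.map (tenCoev Grpd.{v, v} (fundGrpd.obj K) A ≫
        eHomWhiskerLeft Grpd.{v, v} A (tenIso K A).inv)

end Derives

/-! ### The equalizers -/

section Equalizers

variable {C : Type u} [Category.{v} C] {I : Type} [SmallCategory I]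

/-- The arrows `α : j ⟶ i` of `I` where `i` and `j` satisfy `p` and `j` satisfies `q`. -/
structure Arr (p q : I → Prop) where
  src : I
  tgt : I
  hom : src ⟶ tgt
  src_mem : p src
  src_mem' : q src
  tgt_mem : p tgt

variable [HasProducts.{0} C] (P : SSet.{v}ᵒᵖ ⥤ C ⥤ C) (W : I ⥤ SSet.{v}) (p q : I → Prop)

/-- `∏_i X(i)^{W(i)}`, the product over the `i` that satisfy `p`;
here `A^K` is `(P.obj (op K)).obj A`. -/
abbrev prodObj (X : I ⥤ C) : C :=
  ∏ᶜ fun i : {i : I // p i} => (P.obj (op (W.obj i.1))).obj (X.obj i.1)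

/-- `∏_{j ⟶ i} X(i)^{W(j)}`, the product over `Arr p q`. -/
abbrev prodArr (X : I ⥤ C) : C :=
  ∏ᶜ fun a : Arr p q => (P.obj (op (W.obj a.src))).obj (X.obj a.tgt)

/-- The map with component `X(i)^{W(i)} ⟶ X(i)^{W(j)}` at `j ⟶ i`. -/
def leftMap (X : I ⥤ C) : prodObj P W p X ⟶ prodArr P W p q X :=
  Pi.lift fun a => Pi.π _ (⟨a.tgt, a.tgt_mem⟩ : {i : I // p i}) ≫
    (P.map (W.map a.hom).op).app (X.obj a.tgt)

/-- The map with component `X(j)^{W(j)} ⟶ X(i)^{W(j)}` at `j ⟶ i`. -/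
def rightMap (X : I ⥤ C) : prodObj P W p X ⟶ prodArr P W p q X :=
  Pi.lift fun a => Pi.π _ (⟨a.src, a.src_mem⟩ : {i : I // p i}) ≫
    (P.obj (op (W.obj a.src))).map (X.map a.hom)

/-- The map `∏_i X(i)^{W(i)} ⟶ ∏_i Y(i)^{W(i)}` induced by `X ⟶ Y`. -/
def prodObjMap {X Y : I ⥤ C} (f : X ⟶ Y) : prodObj P W p X ⟶ prodObj P W p Y :=
  Limits.Pi.map fun i => (P.obj (op (W.obj i.1))).map (f.app i.1)

/-- The map `∏_{j ⟶ i} X(i)^{W(j)} ⟶ ∏_{j ⟶ i} Y(i)^{W(j)}` induced by `X ⟶ Y`. -/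
def prodArrMap {X Y : I ⥤ C} (f : X ⟶ Y) : prodArr P W p q X ⟶ prodArr P W p q Y :=
  Limits.Pi.map fun a => (P.obj (op (W.obj a.src))).map (f.app a.tgt)

lemma leftMap_natural {X Y : I ⥤ C} (f : X ⟶ Y) :
    prodObjMap P W p f ≫ leftMap P W p q Y = leftMap P W p q X ≫ prodArrMap P W p q f := by
  refine Pi.hom_ext _ _ fun a => ?_
  simp [prodObjMap, prodArrMap, leftMap]

lemma rightMap_natural {X Y : I ⥤ C} (f : X ⟶ Y) :
    prodObjMap P W p f ≫ rightMap P W p q Y = rightMap P W p q X ≫ prodArrMap P W p q f := by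
  refine Pi.hom_ext _ _ fun a => ?_
  simp [prodObjMap, prodArrMap, rightMap, ← Functor.map_comp]

variable [HasEqualizers C]

/-- The equalizer of `∏_i X(i)^{W(i)} ⇉ ∏_{j ⟶ i} X(i)^{W(j)}`, as a functor of `X`. -/
def eqz : (I ⥤ C) ⥤ C where
  obj X := equalizer (leftMap P W p q X) (rightMap P W p q X)
  map {X Y} f := equalizer.lift (equalizer.ι _ _ ≫ prodObjMap P W p f) (by
    rw [Category.assoc, Category.assoc, leftMap_natural, rightMap_natural,
      equalizer.condition_assoc])
  map_id X := by
    apply equalizer.hom_ext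
    refine Pi.hom_ext _ _ fun i => ?_
    simp [prodObjMap]
  map_comp f g := by
    apply equalizer.hom_ext
    refine Pi.hom_ext _ _ fun i => ?_
    simp [prodObjMap]

/-- The inclusion of the equalizer into `∏_i X(i)^{W(i)}`. -/
def eqzι (X : I ⥤ C) : (eqz P W p q).obj X ⟶ prodObj P W p X :=
  equalizer.ι (leftMap P W p q X) (rightMap P W p q X)

variable (I) in
/-- The functor `i ↦ N(I/i)`. -/
def overNerve : I ⥤ SSet.{v} := Over.mapFunctor I ⋙ nerveFunctor ⋙ SSet.uliftFunctor.{v, 0}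

/-- The homotopy limit of an objectwise fibrant diagram `X`, i.e. the equalizer of
`∏_i X(i)^{N(I/i)} ⇉ ∏_{j ⟶ i} X(i)^{N(I/j)}`. -/
def holim : (I ⥤ C) ⥤ C := eqz P (overNerve I) (fun _ => True) (fun _ => True)

/-- The weight `[n] ↦ Δ^n`. -/
abbrev simplices : SimplexCategory ⥤ SSet.{v} := SSet.stdSimplex.{v}

/-- The equalizer of `∏_{i ≤ n} (X^i)^{Δ^i} ⇉ ∏_{[j] ⟶ [i], i ≤ n, j ≤ min m n} (X^i)^{Δ^j}`. -/
def truncTot (n m : ℕ) : (SimplexCategory ⥤ C) ⥤ C :=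
  eqz P simplices (fun i => i.len ≤ n) (fun j => j.len ≤ m)

/-- The inclusion of `truncTot P n m` into `∏_{i ≤ n} (X^i)^{Δ^i}`. -/
def truncTotι (n m : ℕ) (X : SimplexCategory ⥤ C) :
    (truncTot P n m).obj X ⟶ prodObj P simplices (fun i => i.len ≤ n) X :=
  eqzι P simplices (fun i => i.len ≤ n) (fun j => j.len ≤ m) X

end Equalizers

/-! ### The descent groupoid -/

section Descent

open SimplexCategory

/-- A cosimplicial identity on objects. -/
lemma obj_eq (X : SimplexCategory ⥤ Grpd.{v, v}) {i j j' k : SimplexCategory}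
    {f : i ⟶ j} {g : j ⟶ k} {f' : i ⟶ j'} {g' : j' ⟶ k} (h : f ≫ g = f' ≫ g')
    (a : X.obj i) :
    (X.map g).obj ((X.map f).obj a) = (X.map g').obj ((X.map f').obj a) := by
  have := congrArg (fun t => (X.map t : X.obj i ⥤ X.obj k).obj a) h
  simpa only [X.map_comp] using! this

/-- A cosimplicial identity on objects. -/
lemma obj_eq_id (X : SimplexCategory ⥤ Grpd.{v, v}) {i j : SimplexCategory}
    {f : i ⟶ j} {g : j ⟶ i} (h : f ≫ g = 𝟙 i) (a : X.obj i) :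
    (X.map g).obj ((X.map f).obj a) = a := by
  have := congrArg (fun t => (X.map t : X.obj i ⥤ X.obj i).obj a) h
  simpa only [X.map_comp, X.map_id] using! this

lemma map_eqToHom_aux {A B : Type v} [Category.{v} A] [Category.{v} B] (H : A ⥤ B) {x y x' y' : A}
    (f : x ⟶ y) {r r₁ s s₁ : B} (h₁ : r = H.obj x) (h₂ : H.obj y = s) (h₃ : r = r₁)
    (h₄ : r₁ = H.obj x') (h₅ : x' = x) (h₆ : y = y') (h₇ : H.obj y' = s₁) (h₈ : s₁ = s) :
    eqToHom h₁ ≫ H.map f ≫ eqToHom h₂ = eqToHom h₃ ≫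
      (eqToHom h₄ ≫ H.map (eqToHom h₅ ≫ f ≫ eqToHom h₆) ≫ eqToHom h₇) ≫ eqToHom h₈ := by
  subst h₅ h₆ h₄ h₂ h₈
  simp

/-- An object `(a, α : d¹ a ⟶ d⁰ a)` of the descent groupoid of a cosimplicial groupoid `X`, with
`s⁰ α = id` and `d⁰ α ∘ d² α = d¹ α`.  The morphisms `eqToHom` are the identities that express the
cosimplicial identities between objects such as `s⁰ d¹ a = a`. -/
structure Desc (X : SimplexCategory ⥤ Grpd.{v, v}) where
  a : X.obj ⦋0⦌
  α : (X.map (δ 1)).obj a ⟶ (X.map (δ 0)).obj a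
  unit : (X.map (σ 0)).map α = eqToHom ((obj_eq_id X (δ_comp_σ_succ (i := 0)) a).trans
    (obj_eq_id X (δ_comp_σ_self (i := 0)) a).symm)
  cocycle : (X.map (δ 2)).map α ≫
      eqToHom (obj_eq X (δ_comp_δ (i := 0) (j := 1) (by decide)) a) ≫ (X.map (δ 0)).map α =
    eqToHom (obj_eq X (δ_comp_δ_self (i := 1)).symm a) ≫ (X.map (δ 1)).map α ≫
      eqToHom (obj_eq X (δ_comp_δ_self (i := 0)).symm a)

namespace Desc

variable {X Y : SimplexCategory ⥤ Grpd.{v, v}}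

/-- A morphism `(a, α) ⟶ (a', α')`: a morphism `β : a ⟶ a'` with `α' ∘ d¹ β = d⁰ β ∘ α`. -/
@[ext]
structure Hom (x y : Desc X) where
  β : x.a ⟶ y.a
  comm : (X.map (δ 1)).map β ≫ y.α = x.α ≫ (X.map (δ 0)).map β

/-- The descent groupoid. -/
instance : Groupoid (Desc X) where
  Hom := Hom
  id x := ⟨𝟙 _, by simp⟩
  comp f g := ⟨f.β ≫ g.β, by simp [g.comm, reassoc_of% f.comm]⟩
  inv {x y} f := ⟨Groupoid.inv f.β, by
    rw [← cancel_epi ((X.map (δ 1)).map f.β), ← Functor.map_comp_assoc, reassoc_of% f.comm,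
      ← Functor.map_comp]
    simp⟩
  id_comp f := Hom.ext (Category.id_comp f.β)
  comp_id f := Hom.ext (Category.comp_id f.β)
  assoc f g h := Hom.ext (Category.assoc f.β g.β h.β)
  inv_comp f := Hom.ext (Groupoid.inv_comp f.β)
  comp_inv f := Hom.ext (Groupoid.comp_inv f.β)

lemma ext' {x y : Desc X} (h : x.a = y.a)
    (h' : x.α = eqToHom (by rw [h]) ≫ y.α ≫ eqToHom (by rw [h])) : x = y := by
  obtain ⟨a, α, _, _⟩ := x
  obtain ⟨b, α', _, _⟩ := y
  obtain rfl : a = b := h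
  simp at h'
  subst h'
  rfl

lemma comp_β {x y z : Desc X} (f : x ⟶ y) (g : y ⟶ z) : (f ≫ g).β = f.β ≫ g.β := rfl

lemma eqToHom_β {x y : Desc X} (h : x = y) :
    (eqToHom h : x ⟶ y).β = eqToHom (congrArg Desc.a h) := by
  subst h
  rfl

lemma app_obj (F : X ⟶ Y) {i j : SimplexCategory} (f : i ⟶ j) (a : X.obj i) :
    (Y.map f).obj ((F.app i).obj a) = (F.app j).obj ((X.map f).obj a) :=
  (Functor.congr_obj (F.naturality f) a).symm

lemma app_map (F : X ⟶ Y) {i j : SimplexCategory} (f : i ⟶ j) {a b : X.obj i} (φ : a ⟶ b) :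
    (Y.map f).map ((F.app i).map φ) = eqToHom (app_obj F f a) ≫
      (F.app j).map ((X.map f).map φ) ≫ eqToHom (app_obj F f b).symm :=
  Functor.congr_hom (F.naturality f).symm φ

/-- The object `(F a, F α)`. -/
@[simps]
def mapObj (F : X ⟶ Y) (x : Desc X) : Desc Y where
  a := (F.app ⦋0⦌).obj x.a
  α := eqToHom (app_obj F (δ 1) x.a) ≫ (F.app ⦋1⦌).map x.α ≫
    eqToHom (app_obj F (δ 0) x.a).symm
  unit := by
    simp [app_map, x.unit, eqToHom_map]
  cocycle := by
    have := congrArg (F.app ⦋2⦌).map x.cocycle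
    simp only [Functor.map_comp, eqToHom_map] at this
    simp only [Functor.map_comp, eqToHom_map]
    rw [app_map F (δ 2) x.α, app_map F (δ 0) x.α, app_map F (δ 1) x.α]
    simp [reassoc_of% this]

/-- The functor between descent groupoids induced by a morphism of cosimplicial groupoids. -/
def map (F : X ⟶ Y) : Desc X ⥤ Desc Y where
  obj := mapObj F
  map {x y} f := ⟨(F.app ⦋0⦌).map f.β, by
    have := congrArg (F.app ⦋1⦌).map f.comm
    simp only [Functor.map_comp] at this
    change (Y.map (δ 1)).map ((F.app ⦋0⦌).map f.β) ≫ eqToHom _ ≫ (F.app ⦋1⦌).map y.α ≫ eqToHom _ =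
      (eqToHom _ ≫ (F.app ⦋1⦌).map x.α ≫ eqToHom _) ≫ (Y.map (δ 0)).map ((F.app ⦋0⦌).map f.β)
    rw [app_map F (δ 1) f.β, app_map F (δ 0) f.β]
    simp [reassoc_of% this]⟩
  map_id x := Hom.ext ((F.app ⦋0⦌).map_id x.a)
  map_comp f g := Hom.ext ((F.app ⦋0⦌).map_comp f.β g.β)

end Desc

/-- The descent groupoid as a functor of the cosimplicial groupoid. -/
def descFunctor : (SimplexCategory ⥤ Grpd.{v, v}) ⥤ Grpd.{v, v} where
  obj X := Grpd.of (Desc X)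
  map F := Desc.map F
  map_id X := by
    refine CategoryTheory.Functor.ext (fun x => Desc.ext' rfl ?_) (fun x y f => Desc.Hom.ext ?_)
    · change 𝟙 _ ≫ x.α ≫ 𝟙 _ = 𝟙 _ ≫ x.α ≫ 𝟙 _
      rfl
    · rw [Desc.comp_β, Desc.comp_β, Desc.eqToHom_β, Desc.eqToHom_β]
      change f.β = 𝟙 _ ≫ f.β ≫ 𝟙 _
      simp
  map_comp {X Y Z} F G := by
    refine CategoryTheory.Functor.ext (fun x => Desc.ext' rfl ?_) (fun x y f => Desc.Hom.ext ?_)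
    · change eqToHom _ ≫ (G.app ⦋1⦌).map ((F.app ⦋1⦌).map x.α) ≫ eqToHom _ =
        eqToHom _ ≫ (eqToHom _ ≫ (G.app ⦋1⦌).map (eqToHom _ ≫ (F.app ⦋1⦌).map x.α ≫ eqToHom _) ≫
          eqToHom _) ≫ eqToHom _
      exact map_eqToHom_aux (A := Y.obj ⦋1⦌) (B := Z.obj ⦋1⦌) (G.app ⦋1⦌) ((F.app ⦋1⦌).map x.α)
        _ _ _ _ _ _ _ _
    · rw [Desc.comp_β, Desc.comp_β, Desc.eqToHom_β, Desc.eqToHom_β]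
      change (G.app ⦋0⦌).map ((F.app ⦋0⦌).map f.β) =
        𝟙 _ ≫ (G.app ⦋0⦌).map ((F.app ⦋0⦌).map f.β) ≫ 𝟙 _
      simp

end Descent

end

end HolimGrpd

open HolimGrpd

open CategoryTheory Limits MonoidalCategory CartesianMonoidalCategory Opposite Simplicial
  HomotopicalAlgebra

universe w

namespace HolimGrpd

noncomputable section

/-! By Yoneda it suffices to know the maps from an object `B` into each equalizer. The cotensors are
represented by hom groupoids, and maps from the nerve of a category to the nerve of a groupoid are
functors. Hence maps from `B` to an equalizer with weights `N(V(i))` are compatible families of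
functors from `V(i)` to the groupoids `Hom(B, X(i))` (`homFam`). Natural operations on such families
become maps of equalizers (`eqzTrans`), and natural families of paths become maps out of a cylinder
(`exists_cyl_of_fam`). What remains is a comparison of families of functors into groupoids for the
weights `[n]` and `Δ/n`.

For `[n]`, a family is determined by its vertices and edges, which are images of its members on
`[0]` and `[1]`; functoriality only asks for the unit and cocycle conditions, the latter living on
`[2]`. So families are descent data as soon as objects of dimension at most 2 and arrows with source
of dimension at most 1 are included (`descEquivFam`). This identifies `E`, `Tot_2` and, for
groupoids, `Desc`.

The last vertex functor `Δ/n ⥤ [n]` turns families on `[n]` into families on `Δ/n`. In the other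
direction, sending `k` to the vertex `[0] ⟶ [n]` at `k` is not a functor to `Δ/n`. But `Δ/n` has a
terminal object, so a functor from it to a groupoid extends uniquely to the indiscrete groupoid on
its objects, and there any map on objects is a functor. Starting from `[n]`, the round trip is the
identity (`famSimplex_famOver`). Starting from `Δ/n`, it replaces each object by its last vertex,
and the unique morphisms of the indiscrete groupoid give a path to the identity that is natural in
`n` (`famPath`). Thus the comparison map has a strict retraction that is also a homotopy inverse.

For groupoids the homotopy is a natural isomorphism. In the simplicial model category the cylinder
is the tensor with the interval groupoid, and its maps give simplicial homotopies. An endomorphism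
homotopic to the identity is a weak equivalence, by SM7 after cofibrant replacement, and the
comparison map is a retract of such an endomorphism (`weakEquivalence_of_retraction`). -/

/-! ### Indiscrete groupoids -/

section Indiscrete

/-- The groupoid with objects `α` and exactly one morphism between any two objects. -/
@[ext]
structure Indisc (α : Type w) : Type w where
  as : α

instance (α : Type w) : Groupoid.{w} (Indisc α) where
  Hom _ _ := PUnit.{w + 1}
  id _ := ⟨⟩
  comp _ _ := ⟨⟩
  inv _ := ⟨⟩

instance (α : Type w) (x y : Indisc α) : Subsingleton (x ⟶ y) :=
  inferInstanceAs (Subsingleton PUnit)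

namespace Indisc

variable {α β : Type w} {D : Type u'} [Category.{v'} D]

/-- The functor to an indiscrete groupoid given by a map on objects. -/
def functor (f : D → α) : D ⥤ Indisc α where
  obj d := ⟨f d⟩
  map _ := ⟨⟩

lemma functor_ext {F G : D ⥤ Indisc α} (h : ∀ d, F.obj d = G.obj d) : F = G :=
  CategoryTheory.Functor.ext h (fun _ _ _ => Subsingleton.elim _ _)

end Indisc

/-- The groupoid with two isomorphic objects. -/
def interval : Grpd.{v, v} := Grpd.of (Indisc (ULift.{v} Bool))

/-- The endpoints of the interval. -/
def interval.pt (b : Bool) : interval.{v} := (⟨⟨b⟩⟩ : Indisc (ULift.{v} Bool))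

/-- The morphism between the endpoints of the interval. -/
def interval.arrow : interval.pt.{v} false ⟶ interval.pt true :=
  (PUnit.unit : (⟨⟨false⟩⟩ : Indisc (ULift.{v} Bool)) ⟶ ⟨⟨true⟩⟩)

/-- The path groupoid `Fun(interval, G)`, as a functor of `G`. -/
abbrev grpdPath : Grpd.{v, v} ⥤ Grpd.{v, v} := grpdFun.obj (op interval)

/-- The endpoints of a path. -/
def grpdPathEnd (b : Bool) : grpdPath.{v} ⟶ 𝟭 Grpd.{v, v} where
  app G := (evaluation interval.{v} G).obj (interval.pt b)

end Indiscrete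

/-! ### Families of functors -/

section Fam

variable {I : Type} [SmallCategory I]

/-- A family of functors `V(i) ⥤ Y(i)`, over the `i` that satisfy `p`, which is compatible with the
arrows in `Arr p q`. -/
@[ext]
structure Fam (V : I ⥤ Cat.{0, 0}) (p q : I → Prop) (Y : I ⥤ Grpd.{v, v}) where
  fn (i : {i : I // p i}) : V.obj i.1 ⥤ Y.obj i.1
  comm (a : Arr p q) : (V.map a.hom).toFunctor ⋙ fn ⟨a.tgt, a.tgt_mem⟩ =
    fn ⟨a.src, a.src_mem⟩ ⋙ (Y.map a.hom : Y.obj a.src ⥤ Y.obj a.tgt)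

namespace Fam

variable {V V' : I ⥤ Cat.{0, 0}} {p q p' q' : I → Prop} {Y Y' : I ⥤ Grpd.{v, v}}

/-- The family induced by `Y ⟶ Y'`. -/
def map (g : Y ⟶ Y') (F : Fam V p q Y) : Fam V p q Y' where
  fn i := F.fn i ⋙ (g.app i.1 : Y.obj i.1 ⥤ Y'.obj i.1)
  comm a := by
    have h : (Y.map a.hom ⋙ g.app a.tgt : Y.obj a.src ⥤ Y'.obj a.tgt) =
      g.app a.src ⋙ Y'.map a.hom := g.naturality a.hom
    rw [← Functor.assoc, F.comm, Functor.assoc, Functor.assoc, h]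

lemma map_map {Y'' : I ⥤ Grpd.{v, v}} (g : Y ⟶ Y') (g' : Y' ⟶ Y'') (F : Fam V p q Y) :
    (F.map g).map g' = F.map (g ≫ g') := rfl

/-- The family induced by a morphism `V' ⟶ V`. -/
def precomp (u : V' ⟶ V) (F : Fam V p q Y) : Fam V' p q Y where
  fn i := (u.app i.1).toFunctor ⋙ F.fn i
  comm a := by
    have h := congrArg Cat.Hom.toFunctor (u.naturality a.hom)
    rw [Cat.Hom.comp_toFunctor, Cat.Hom.comp_toFunctor] at h
    rw [← Functor.assoc, h, Functor.assoc, F.comm, Functor.assoc]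

/-- Restriction of a family to fewer objects and arrows. -/
def restrict (hp : ∀ i, p' i → p i) (hq : ∀ i, q' i → q i) (F : Fam V p q Y) : Fam V p' q' Y where
  fn i := F.fn ⟨i.1, hp _ i.2⟩
  comm a := F.comm ⟨a.src, a.tgt, a.hom, hp _ a.src_mem, hq _ a.src_mem', hp _ a.tgt_mem⟩

end Fam

/-- An identification of maps from the weight `W(i)` to nerves of groupoids with functors
on `V(i)`. -/
structure NerveWeight (W : I ⥤ SSet.{v}) (V : I ⥤ Cat.{0, 0}) where
  equiv (i : I) (G : Grpd.{v, v}) : (W.obj i ⟶ grpdNerve.obj G) ≃ (V.obj i ⥤ G)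
  equiv_comp {i : I} {G G' : Grpd.{v, v}} (φ : W.obj i ⟶ grpdNerve.obj G) (g : G ⟶ G') :
    equiv i G' (φ ≫ grpdNerve.map g) = equiv i G φ ⋙ (g : G ⥤ G')
  equiv_map {i j : I} {G : Grpd.{v, v}} (f : j ⟶ i) (φ : W.obj i ⟶ grpdNerve.obj G) :
    equiv j G (W.map f ≫ φ) = (V.map f).toFunctor ⋙ equiv i G φ

end Fam

/-! ### Cotensors that are represented by hom groupoids -/

section Represented

variable {C : Type u} [Category.{v} C]

/-- Hom groupoids that represent the cotensor `P`, together with cylinders. -/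
structure GrpdRepr (P : SSet.{v}ᵒᵖ ⥤ C ⥤ C) where
  hom : Cᵒᵖ ⥤ C ⥤ Grpd.{v, v}
  powEquiv (K : SSet.{v}) (A B : C) :
    (B ⟶ (P.obj (op K)).obj A) ≃ (K ⟶ grpdNerve.obj ((hom.obj (op B)).obj A))
  powEquiv_precomp {K : SSet.{v}} {A B B' : C} (b : B' ⟶ B) (f : B ⟶ (P.obj (op K)).obj A) :
    powEquiv K A B' (b ≫ f) = powEquiv K A B f ≫ grpdNerve.map ((hom.map b.op).app A)
  powEquiv_map {K : SSet.{v}} {A A' B : C} (a : A ⟶ A') (f : B ⟶ (P.obj (op K)).obj A) :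
    powEquiv K A' B (f ≫ (P.obj (op K)).map a) =
      powEquiv K A B f ≫ grpdNerve.map ((hom.obj (op B)).map a)
  powEquiv_weight {K K' : SSet.{v}} {A B : C} (κ : K' ⟶ K) (f : B ⟶ (P.obj (op K)).obj A) :
    powEquiv K' A B (f ≫ (P.map κ.op).app A) = κ ≫ powEquiv K A B f
  cyl : C → C
  ι (b : Bool) (B : C) : B ⟶ cyl B
  cylLift (B : C) : hom.obj (op B) ⋙ grpdPath ⟶ hom.obj (op (cyl B))
  cylLift_ι (b : Bool) (B A : C) : (cylLift B).app A ≫ (hom.map (ι b B).op).app A =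
    (grpdPathEnd b).app _

variable {P : SSet.{v}ᵒᵖ ⥤ C ⥤ C} (R : GrpdRepr P) {I : Type} [SmallCategory I]
  {W W' : I ⥤ SSet.{v}} {V V' : I ⥤ Cat.{0, 0}} (N : NerveWeight W V) (N' : NerveWeight W' V')
  {p q p' q' : I → Prop}

/-- The functor `V(i) ⥤ Hom(B, A)` that corresponds to `B ⟶ A^{W(i)}`. -/
def weightEquiv (i : I) (A B : C) :
    (B ⟶ (P.obj (op (W.obj i))).obj A) ≃ (V.obj i ⥤ (R.hom.obj (op B)).obj A) :=
  (R.powEquiv _ _ _).trans (N.equiv i _)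

lemma weightEquiv_precomp (i : I) {A B B' : C} (b : B' ⟶ B)
    (f : B ⟶ (P.obj (op (W.obj i))).obj A) :
    weightEquiv R N i A B' (b ≫ f) = weightEquiv R N i A B f ⋙
      ((R.hom.map b.op).app A : (R.hom.obj (op B)).obj A ⥤ (R.hom.obj (op B')).obj A) := by
  dsimp only [weightEquiv, Equiv.trans_apply]
  rw [R.powEquiv_precomp, N.equiv_comp]

lemma weightEquiv_postcomp (i : I) {A A' B : C} (a : A ⟶ A')
    (f : B ⟶ (P.obj (op (W.obj i))).obj A) :
    weightEquiv R N i A' B (f ≫ (P.obj (op (W.obj i))).map a) = weightEquiv R N i A B f ⋙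
      ((R.hom.obj (op B)).map a : (R.hom.obj (op B)).obj A ⥤ (R.hom.obj (op B)).obj A') := by
  dsimp only [weightEquiv, Equiv.trans_apply]
  rw [R.powEquiv_map, N.equiv_comp]

lemma weightEquiv_weight {i j : I} (κ : j ⟶ i) {A B : C}
    (f : B ⟶ (P.obj (op (W.obj i))).obj A) :
    weightEquiv R N j A B (f ≫ (P.map (W.map κ).op).app A) =
      (V.map κ).toFunctor ⋙ weightEquiv R N i A B f := by
  dsimp only [weightEquiv, Equiv.trans_apply]
  rw [R.powEquiv_weight, N.equiv_map]

variable [HasProducts.{0} C] [HasEqualizers C]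

lemma eqz_hom_ext {X : I ⥤ C} {B : C} {f g : B ⟶ (eqz P W p q).obj X}
    (h : ∀ i, f ≫ eqzι P W p q X ≫ Pi.π _ i = g ≫ eqzι P W p q X ≫ Pi.π _ i) : f = g := by
  apply equalizer.hom_ext
  refine Pi.hom_ext _ _ fun i => ?_
  exact (Category.assoc _ _ _).trans ((h i).trans (Category.assoc _ _ _).symm)

lemma eqz_condition (X : I ⥤ C) (a : Arr p q) :
    eqzι P W p q X ≫ Pi.π _ (⟨a.tgt, a.tgt_mem⟩ : {i : I // p i}) ≫
      (P.map (W.map a.hom).op).app (X.obj a.tgt) =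
    eqzι P W p q X ≫ Pi.π _ (⟨a.src, a.src_mem⟩ : {i : I // p i}) ≫
      (P.obj (op (W.obj a.src))).map (X.map a.hom) := by
  have h : eqzι P W p q X ≫ leftMap P W p q X = eqzι P W p q X ≫ rightMap P W p q X :=
    equalizer.condition _ _
  have := congrArg (fun t => t ≫ Pi.π _ a) h
  simpa only [leftMap, rightMap, Category.assoc, Pi.lift_π] using this

/-- Construction of maps to the equalizer. -/
def eqzLift {X : I ⥤ C} {B : C} (f : ∀ i : {i : I // p i}, B ⟶ (P.obj (op (W.obj i.1))).obj
    (X.obj i.1)) (hf : ∀ a : Arr p q, f ⟨a.tgt, a.tgt_mem⟩ ≫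
      (P.map (W.map a.hom).op).app (X.obj a.tgt) =
        f ⟨a.src, a.src_mem⟩ ≫ (P.obj (op (W.obj a.src))).map (X.map a.hom)) :
    B ⟶ (eqz P W p q).obj X :=
  equalizer.lift (Pi.lift f) (by
    refine Pi.hom_ext _ _ fun a => ?_
    simpa [leftMap, rightMap] using hf a)

@[simp]
lemma eqzLift_π {X : I ⥤ C} {B : C} (f : ∀ i : {i : I // p i}, B ⟶ (P.obj (op (W.obj i.1))).obj
    (X.obj i.1)) (hf) (i) :
    eqzLift (q := q) f hf ≫ eqzι P W p q X ≫ Pi.π _ i = f i := by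
  refine (Category.assoc _ _ _).symm.trans ?_
  refine (congrArg (fun t => t ≫ Pi.π _ i) (equalizer.lift_ι _ _)).trans ?_
  exact Pi.lift_π _ _

lemma eqz_map_π {X X' : I ⥤ C} (x : X ⟶ X') (i : {i : I // p i}) :
    (eqz P W p q).map x ≫ eqzι P W p q X' ≫ Pi.π _ i =
      eqzι P W p q X ≫ Pi.π _ i ≫ (P.obj (op (W.obj i.1))).map (x.app i.1) := by
  refine (Category.assoc _ _ _).symm.trans ?_
  refine (congrArg (fun t => t ≫ Pi.π _ i) (equalizer.lift_ι _ _)).trans ?_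
  refine (Category.assoc _ _ _).trans ?_
  exact congrArg (fun t => eqzι P W p q X ≫ t) (Pi.map_π _ _)

/-- Maps to the equalizer are compatible families of functors. -/
def homFam (X : I ⥤ C) (B : C) :
    (B ⟶ (eqz P W p q).obj X) ≃ Fam V p q (X ⋙ R.hom.obj (op B)) where
  toFun f :=
    { fn := fun i => weightEquiv R N i.1 (X.obj i.1) B (f ≫ eqzι P W p q X ≫ Pi.π _ i)
      comm := fun a => by
        refine (weightEquiv_weight R N a.hom _).symm.trans ?_
        refine Eq.trans ?_ (weightEquiv_postcomp R N a.src (X.map a.hom) _)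
        simp only [Category.assoc, eqz_condition] }
  invFun F := eqzLift (fun i => (weightEquiv R N i.1 (X.obj i.1) B).symm (F.fn i)) (fun a => by
    apply (weightEquiv R N _ _ _).injective
    rw [weightEquiv_weight, weightEquiv_postcomp, Equiv.apply_symm_apply, Equiv.apply_symm_apply]
    exact F.comm a)
  left_inv f := eqz_hom_ext fun i => by simp
  right_inv F := by
    ext i : 2
    simp

lemma homFam_precomp (X : I ⥤ C) {B B' : C} (b : B' ⟶ B) (f : B ⟶ (eqz P W p q).obj X) :
    homFam R N X B' (b ≫ f) =
      (homFam R N X B f).map (Functor.whiskerLeft X (R.hom.map b.op)) := by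
  ext i : 2
  refine Eq.trans ?_ (weightEquiv_precomp R N i.1 b _)
  simp [homFam]

lemma homFam_postcomp {X X' : I ⥤ C} (x : X ⟶ X') {B : C} (f : B ⟶ (eqz P W p q).obj X) :
    homFam R N X' B (f ≫ (eqz P W p q).map x) =
      (homFam R N X B f).map (Functor.whiskerRight x (R.hom.obj (op B))) := by
  ext i : 2
  refine Eq.trans ?_ (weightEquiv_postcomp R N i.1 (x.app i.1) _)
  simp [homFam, eqz_map_π]

/-- A map of families, natural in the diagram of groupoids. -/
structure FamHom (V V' : I ⥤ Cat.{0, 0}) (p q p' q' : I → Prop) where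
  app {Y : I ⥤ Grpd.{v, v}} (F : Fam V p q Y) : Fam V' p' q' Y
  naturality {Y Y' : I ⥤ Grpd.{v, v}} (g : Y ⟶ Y') (F : Fam V p q Y) :
    app (F.map g) = (app F).map g

/-- The map of equalizers induced by a natural map of families. -/
def eqzTrans (T : FamHom.{v} V V' p q p' q') : eqz P W p q ⟶ eqz P W' p' q' where
  app X := (homFam R N' X _).symm (T.app (homFam R N X _ (𝟙 _)))
  naturality X X' x := by
    -- Both composites are compared through the families they classify; the identity classifies the
    -- universal family, to which the naturality of `T` applies.
    apply (homFam R N' X' _).injective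
    rw [homFam_precomp, homFam_postcomp, Equiv.apply_symm_apply, Equiv.apply_symm_apply,
      ← T.naturality, ← T.naturality, ← homFam_precomp, ← homFam_postcomp, Category.id_comp,
      Category.comp_id]

/-- Yoneda: the family of `f` is the universal family pulled back along `f`, and `T` commutes with
this pullback. -/
lemma homFam_eqzTrans (T : FamHom.{v} V V' p q p' q') {X : I ⥤ C} {B : C}
    (f : B ⟶ (eqz P W p q).obj X) :
    homFam R N' X B (f ≫ (eqzTrans R N N' T).app X) = T.app (homFam R N X B f) := by
  rw [homFam_precomp, eqzTrans, Equiv.apply_symm_apply, ← T.naturality, ← homFam_precomp,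
    Category.comp_id]

/-- Two maps to the equalizer are homotopic if the corresponding families are the ends of a family
of paths. -/
lemma exists_cyl_of_fam {X : I ⥤ C} {B : C} (f₀ f₁ : B ⟶ (eqz P W p q).obj X)
    (H : Fam V p q ((X ⋙ R.hom.obj (op B)) ⋙ grpdPath))
    (h₀ : H.map (Functor.whiskerLeft (X ⋙ R.hom.obj (op B)) (grpdPathEnd false)) =
      homFam R N X B f₀)
    (h₁ : H.map (Functor.whiskerLeft (X ⋙ R.hom.obj (op B)) (grpdPathEnd true)) =
      homFam R N X B f₁) :
    ∃ h : R.cyl B ⟶ (eqz P W p q).obj X, R.ι false B ≫ h = f₀ ∧ R.ι true B ≫ h = f₁ := by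
  -- A family of paths in `Hom(B, X(i))` becomes a family in `Hom(cyl B, X(i))`, hence a map out of
  -- the cylinder; `cylLift_ι` identifies its ends.
  let H' : Fam V p q (X ⋙ R.hom.obj (op (R.cyl B))) := H.map (Functor.whiskerLeft X (R.cylLift B))
  have key (b : Bool) : homFam R N X B (R.ι b B ≫ (homFam R N X _).symm H') =
      H.map (Functor.whiskerLeft (X ⋙ R.hom.obj (op B)) (grpdPathEnd b)) := by
    rw [homFam_precomp, Equiv.apply_symm_apply]
    refine (Fam.map_map _ _ _).trans ?_
    congr 1
    ext i : 2
    exact R.cylLift_ι b B (X.obj i)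
  refine ⟨(homFam R N X _).symm H', ?_, ?_⟩
  · exact (homFam R N X B).injective ((key false).trans h₀)
  · exact (homFam R N X B).injective ((key true).trans h₁)

end Represented

/-! ### Nerves as weights -/

section Weights

/-- The map from the nerve of a small category `D` to the nerve of `G` given by a functor. -/
def uliftNerveMap {D : Type} [SmallCategory D] {G : Type v} [SmallCategory G] (F : D ⥤ G) :
    SSet.uliftFunctor.{v, 0}.obj (nerve D) ⟶ nerve G where
  app _ := ↾fun x => (x.down ⋙ F : _ ⥤ G)

/-- The 0-simplices recover the functor on objects and the 1-simplices recover it on morphisms. -/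
lemma uliftNerveMap_injective {D : Type} [SmallCategory D] {G : Type v} [SmallCategory G] :
    Function.Injective (uliftNerveMap (D := D) (G := G)) := by
  intro F F' h
  have key (n : ℕ) (x : ComposableArrows D n) : x ⋙ F = x ⋙ F' :=
    congrArg (fun t => t.app (op ⦋n⦌) ⟨x⟩) h
  refine CategoryTheory.Functor.ext (fun d => ?_) (fun d d' f => ?_)
  · exact Functor.congr_obj (key 0 (ComposableArrows.mk₀ d)) 0
  · exact Functor.congr_hom (key 1 (ComposableArrows.mk₁ f)) (homOfLE (Fin.zero_le 1))

/-- Fullness of the nerve applies within one universe, so `D` is first replaced by its copy `AsSmall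
D`. -/
lemma uliftNerveMap_surjective {D : Type} [SmallCategory D] {G : Type v} [SmallCategory G] :
    Function.Surjective (uliftNerveMap (D := D) (G := G)) := by
  intro φ
  let D' := AsSmall.{v} D
  let U : D ⥤ D' := AsSmall.up
  let L : D' ⥤ D := AsSmall.down
  let ψ : nerve D' ⟶ SSet.uliftFunctor.{v, 0}.obj (nerve D) :=
    { app _ := ↾fun x => ⟨(x ⋙ L : _ ⥤ D)⟩ }
  obtain ⟨F, hF⟩ := nerveFunctor.{v, v}.map_surjective (X := Cat.of D') (Y := Cat.of G) (ψ ≫ φ)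
  refine ⟨U ⋙ F.toFunctor, ?_⟩
  ext n ⟨x⟩
  exact congrArg (fun t => t.app n (x ⋙ U)) hF

/-- Maps from the nerve of a small category `D` to the nerve of `G` are functors. -/
def uliftNerveEquiv (D : Type) [SmallCategory D] (G : Type v) [SmallCategory G] :
    (D ⥤ G) ≃ (SSet.uliftFunctor.{v, 0}.obj (nerve D) ⟶ nerve G) :=
  Equiv.ofBijective uliftNerveMap ⟨uliftNerveMap_injective, uliftNerveMap_surjective⟩

/-- The weight given by the nerves of a diagram of small categories. -/
def nerveWeight {I : Type} [SmallCategory I] (V : I ⥤ Cat.{0, 0}) :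
    NerveWeight (V ⋙ nerveFunctor ⋙ SSet.uliftFunctor.{v, 0}) V where
  equiv i G := (uliftNerveEquiv (V.obj i) G).symm
  equiv_comp {i G G'} φ g := by
    obtain ⟨F, rfl⟩ := (uliftNerveEquiv (V.obj i) G).surjective φ
    refine ((uliftNerveEquiv (V.obj i) G').symm_apply_eq).2 ?_
    exact congrArg (fun t => uliftNerveEquiv (V.obj i) G' (t ⋙ (g : G ⥤ G')))
      ((uliftNerveEquiv (V.obj i) G).symm_apply_apply F).symm
  equiv_map {i j G} f φ := by
    obtain ⟨F, rfl⟩ := (uliftNerveEquiv (V.obj i) G).surjective φ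
    refine ((uliftNerveEquiv (V.obj j) G).symm_apply_eq).2 ?_
    exact congrArg (fun t => uliftNerveEquiv (V.obj j) G ((V.map f).toFunctor ⋙ t))
      ((uliftNerveEquiv (V.obj i) G).symm_apply_apply F).symm

/-- The nerves of the categories `I/i` as a weight. -/
def overWeight (I : Type) [SmallCategory I] :
    NerveWeight (overNerve.{v} I) (Over.mapFunctor I) :=
  nerveWeight _

/-- The standard simplices as a weight. -/
def simplexWeight : NerveWeight simplices.{v} SimplexCategory.toCat where
  equiv n G := SSet.yonedaEquiv (X := grpdNerve.obj G) (n := n)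
  equiv_comp _ _ := rfl
  equiv_map {i j _} f φ :=
    (uliftYonedaEquiv_naturality (X := op i) (Y := op j) φ f.op).symm

end Weights

/-! ### Functors to groupoids on categories with a terminal object -/

section Extend

variable {D : Type w} [Category.{v'} D] {t : D} {G : Type v} [Groupoid.{u'} G]

/-- The extension to the indiscrete groupoid on the objects of `D` of a functor from a category `D`
with a terminal object to a groupoid. -/
def extendIndisc (ht : IsTerminal t) (F : D ⥤ G) : Indisc D ⥤ G where
  obj d := F.obj d.as
  map {d d'} _ := F.map (ht.from d.as) ≫ Groupoid.inv (F.map (ht.from d'.as))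

/-- A morphism `f : d ⟶ d'` followed by `d' ⟶ t` is `d ⟶ t`, so `F.map f` is forced to be the chosen
composite through `F.obj t`. -/
lemma functor_extendIndisc (ht : IsTerminal t) (F : D ⥤ G) :
    Indisc.functor id ⋙ extendIndisc ht F = F := by
  refine CategoryTheory.Functor.ext (fun _ => rfl) (fun d d' f => ?_)
  change F.map (ht.from d) ≫ Groupoid.inv (F.map (ht.from d')) = 𝟙 _ ≫ F.map f ≫ 𝟙 _
  rw [← ht.comp_from f, F.map_comp]
  simp

/-- Every morphism of the indiscrete groupoid is a morphism to `t` followed by the inverse of one,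
and morphisms to `t` come from `D`. With `functor_extendIndisc` this makes the extension unique. -/
lemma indisc_functor_ext (ht : IsTerminal t) {F F' : Indisc D ⥤ G}
    (h : Indisc.functor id ⋙ F = Indisc.functor id ⋙ F') : F = F' := by
  have hobj (d : Indisc D) : F.obj d = F'.obj d := Functor.congr_obj h d.as
  refine CategoryTheory.Functor.ext hobj (fun d d' f => ?_)
  have key (e : Indisc D) (g : e ⟶ ⟨t⟩) : F.map g = eqToHom (hobj e) ≫
    F'.map g ≫ eqToHom (hobj ⟨t⟩).symm := Functor.congr_hom h (ht.from e.as)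
  let g : d ⟶ ⟨t⟩ := PUnit.unit
  let g' : d' ⟶ ⟨t⟩ := PUnit.unit
  obtain rfl : f = g ≫ inv g' := Subsingleton.elim _ _
  simp [key _ g, key _ g']

end Extend

/-! ### Families on slices and on indiscrete groupoids -/

section Weights

variable (I : Type) [SmallCategory I]

/-- The diagram of the indiscrete groupoids on the objects of `I/i`. -/
def indiscOver : I ⥤ Cat.{0, 0} where
  obj i := Cat.of (Indisc (Over i))
  map f := (Indisc.functor fun x => (Over.map f).obj x.as : Indisc (Over _) ⥤ _).toCatHom
  map_id i := Cat.ext (Indisc.functor_ext fun d =>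
    congrArg Indisc.mk (Functor.congr_obj (Over.mapId_eq i) d.as))
  map_comp f g := Cat.ext (Indisc.functor_ext fun d =>
    congrArg Indisc.mk (Functor.congr_obj (Over.mapComp_eq f g) d.as))

/-- The map from `I/i` to the indiscrete groupoid on its objects. -/
def toIndiscOver : Over.mapFunctor I ⟶ indiscOver I where
  app i := (Indisc.functor id : Over i ⥤ Indisc (Over i)).toCatHom
  naturality _ _ _ := rfl

variable {I}

/-- The extension of a family on the categories `I/i` to the indiscrete groupoids. -/
def Fam.extend {Y : I ⥤ Grpd.{v, v}} {p q : I → Prop} (F : Fam (Over.mapFunctor I) p q Y) :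
    Fam (indiscOver I) p q Y where
  fn i := extendIndisc Over.mkIdTerminal (F.fn i)
  comm a := by
    -- By uniqueness of extensions, compatibility need only be checked on the slice, where it is
    -- that of `F`.
    refine indisc_functor_ext (D := Over a.src) Over.mkIdTerminal ?_
    have h₁ := functor_extendIndisc Over.mkIdTerminal (F.fn ⟨a.tgt, a.tgt_mem⟩)
    have h₂ := functor_extendIndisc Over.mkIdTerminal (F.fn ⟨a.src, a.src_mem⟩)
    refine (congrArg (fun t => (Over.map a.hom) ⋙ t) h₁).trans ?_
    refine (F.comm a).trans ?_
    exact congrArg (fun t => t ⋙ (Y.map a.hom : Y.obj a.src ⥤ Y.obj a.tgt)) h₂.symm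

lemma Fam.precomp_extend {Y : I ⥤ Grpd.{v, v}} {p q : I → Prop}
    (F : Fam (Over.mapFunctor I) p q Y) : F.extend.precomp (toIndiscOver I) = F := by
  ext i : 2
  exact functor_extendIndisc Over.mkIdTerminal (F.fn i)

lemma Fam.ext_indiscOver {Y : I ⥤ Grpd.{v, v}} {p q : I → Prop} {F F' : Fam (indiscOver I) p q Y}
    (h : F.precomp (toIndiscOver I) = F'.precomp (toIndiscOver I)) : F = F' := by
  ext i : 2
  exact indisc_functor_ext (D := Over i.1) Over.mkIdTerminal (congrArg (fun t => t.fn i) h)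

end Weights

/-! ### Last vertices: comparison of `Δ/n` with `[n]` -/

section Simplex

/-- The last vertex functors `Δ/n ⥤ [n]`. -/
def lastVertex : Over.mapFunctor SimplexCategory ⟶ SimplexCategory.toCat where
  app n := Functor.toCatHom (C := Over n) (D := Fin (n.len + 1))
    { obj := fun f => f.hom.toOrderHom (Fin.last _)
      map := fun {f f'} g => homOfLE (by
        rw [← Over.w g]
        exact f'.hom.toOrderHom.monotone (Fin.le_last _)) }
  naturality _ _ _ := rfl

/-- The vertices `[n] ⥤ Δ/n`, with values in the indiscrete groupoid on the objects of `Δ/n`. -/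
def vertices : SimplexCategory.toCat ⟶ indiscOver SimplexCategory where
  app n := Functor.toCatHom (C := Fin (n.len + 1)) (D := Indisc (Over n))
    (Indisc.functor fun k => Over.mk (SimplexCategory.const ⦋0⦌ n k))
  naturality _ _ _ := Cat.ext (Indisc.functor_ext fun _ => rfl)

variable {Y : SimplexCategory ⥤ Grpd.{v, v}} {p q : SimplexCategory → Prop}

/-- The map from simplices to families on `Δ/n`. -/
def famOver : FamHom.{v} SimplexCategory.toCat (Over.mapFunctor SimplexCategory) p q p q where
  app F := F.precomp lastVertex
  naturality _ _ := rfl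

/-- The map from families on `Δ/n` to simplices. -/
def famSimplex : FamHom.{v} (Over.mapFunctor SimplexCategory) SimplexCategory.toCat p q p q where
  app F := F.extend.precomp vertices
  naturality g F := by
    change _ = (F.extend.map g).precomp vertices
    congr 1
    -- Extension commutes with maps of diagrams because both sides extend the same family on the
    -- slices.
    apply Fam.ext_indiscOver
    rw [Fam.precomp_extend]
    exact congrArg (Fam.map g) F.precomp_extend.symm

/-- The last vertex of `[0] ⟶ [n]` at `k` is `k`, so the round trip fixes objects. For morphisms,
`F` is itself extended to the indiscrete groupoid on `[n]`, which has the terminal object `n`; by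
uniqueness the extension over `Δ/n` factors through it. -/
lemma famSimplex_famOver (F : Fam SimplexCategory.toCat p q Y) :
    famSimplex.app (famOver.app F) = F := by
  ext n : 2
  have ht : IsTerminal (Fin.last n.1.len : Fin (n.1.len + 1)) :=
    IsTerminal.ofUniqueHom (fun k => homOfLE (Fin.le_last k)) (fun _ _ => Subsingleton.elim _ _)
  have h₁ : extendIndisc Over.mkIdTerminal ((lastVertex.app n.1).toFunctor ⋙ F.fn n) =
      (Indisc.functor (fun x => (lastVertex.app n.1).toFunctor.obj x.as) :
        Indisc (Over n.1) ⥤ Indisc (Fin (n.1.len + 1))) ⋙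
        extendIndisc (D := Fin (n.1.len + 1)) ht (F.fn n) := by
    apply indisc_functor_ext (D := Over n.1) Over.mkIdTerminal
    rw [functor_extendIndisc]
    exact congrArg (fun t => (lastVertex.app n.1).toFunctor ⋙ t)
      (functor_extendIndisc (D := Fin (n.1.len + 1)) ht (F.fn n)).symm
  have h₂ := functor_extendIndisc (D := Fin (n.1.len + 1)) ht (F.fn n)
  exact (congrArg (fun t => (vertices.app n.1).toFunctor ⋙ t) h₁).trans h₂

/-- The paths from the last vertex of `[m] ⟶ [n]` to `[m] ⟶ [n]`. -/
def lastVertexPath (n : SimplexCategory) : Over n ⥤ (interval.{v} ⥤ Indisc (Over n)) where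
  obj x := Indisc.functor fun b : Indisc (ULift.{v} Bool) =>
    -- The end `false` is `vertices` applied to `lastVertex`, the end `true` is the object itself;
    -- the morphism between them exists because the target is indiscrete.
    if b.as.down then x else Over.mk (SimplexCategory.const ⦋0⦌ n (x.hom.toOrderHom (Fin.last _)))
  map _ := { app := fun _ => ⟨⟩ }

/-- The family of paths from the last vertex. -/
def famPath (F : Fam (Over.mapFunctor SimplexCategory) p q Y) :
    Fam (Over.mapFunctor SimplexCategory) p q (Y ⋙ grpdPath) where
  fn n := lastVertexPath n.1 ⋙
    (Functor.whiskeringRight interval.{v} (Indisc (Over n.1)) (Y.obj n.1)).obj (F.extend.fn n)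
  comm a := by
    -- Composition with `a.hom` strictly preserves the choice of last vertex, so the paths are
    -- natural in `n`.
    have h₁ : Over.map a.hom ⋙ lastVertexPath a.tgt = lastVertexPath a.src ⋙
        (Functor.whiskeringRight interval.{v} _ _).obj
          ((indiscOver SimplexCategory).map a.hom).toFunctor :=
      CategoryTheory.Functor.ext (fun x => Indisc.functor_ext
        fun b : Indisc (ULift.{v} Bool) => match b with
          | ⟨⟨true⟩⟩ => rfl
          | ⟨⟨false⟩⟩ => rfl) (fun _ _ _ => by
          ext : 2
          exact Subsingleton.elim (α := PUnit) _ _)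
    have h₂ := F.extend.comm a
    refine (congrArg (fun t => t ⋙ (Functor.whiskeringRight interval.{v} (Indisc (Over a.tgt))
      (Y.obj a.tgt)).obj (F.extend.fn ⟨a.tgt, a.tgt_mem⟩)) h₁).trans ?_
    exact congrArg (fun t => lastVertexPath a.src ⋙
      (Functor.whiskeringRight interval.{v} (Indisc (Over a.src)) (Y.obj a.tgt)).obj t) h₂

lemma famPath_false (F : Fam (Over.mapFunctor SimplexCategory) p q Y) :
    (famPath F).map (Functor.whiskerLeft Y (grpdPathEnd false)) =
      famOver.app (famSimplex.app F) :=
  rfl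

lemma famPath_true (F : Fam (Over.mapFunctor SimplexCategory) p q Y) :
    (famPath F).map (Functor.whiskerLeft Y (grpdPathEnd true)) = F :=
  (show _ = F.extend.precomp (toIndiscOver _) from rfl).trans F.precomp_extend

end Simplex

/-! ### Descent data and families of simplices -/

section DescFam

open SimplexCategory

variable {Y Y' : SimplexCategory ⥤ Grpd.{v, v}}

lemma map_obj_comp (Y : SimplexCategory ⥤ Grpd.{v, v}) {i j k : SimplexCategory} (f : i ⟶ j)
    (g : j ⟶ k) {h : i ⟶ k} (w : f ≫ g = h) (a : Y.obj i) :
    (Y.map h).obj a = (Y.map g).obj ((Y.map f).obj a) := by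
  subst w
  exact Functor.congr_obj (Y.map_comp f g) a

lemma map_map_comp (Y : SimplexCategory ⥤ Grpd.{v, v}) {i j k : SimplexCategory} (f : i ⟶ j)
    (g : j ⟶ k) {h : i ⟶ k} (w : f ≫ g = h) {a b : Y.obj i} (φ : a ⟶ b) :
    (Y.map g).map ((Y.map f).map φ) = eqToHom (map_obj_comp Y f g w a).symm ≫
      (Y.map h).map φ ≫ eqToHom (map_obj_comp Y f g w b) := by
  subst w
  exact Functor.congr_hom (Y.map_comp f g).symm φ

lemma eqToHom_conj_eq_iff {D : Type u'} [Category.{v'} D] {a b c d : D} (h₁ : a = b) (h₂ : c = d)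
    (φ : b ⟶ c) (ψ : a ⟶ d) :
    eqToHom h₁ ≫ φ ≫ eqToHom h₂ = ψ ↔ φ = eqToHom h₁.symm ≫ ψ ≫ eqToHom h₂.symm := by
  subst h₁ h₂
  simp

lemma eqToHom_conj_conj_conj {D : Type u'} [Category.{v'} D] {a₀ a₁ a₂ a₃ b₀ b₁ b₂ b₃ : D}
    (φ : a₃ ⟶ b₃) (h₁ : a₀ = a₁) (h₂ : a₁ = a₂) (h₃ : a₂ = a₃) (h₄ : b₃ = b₂) (h₅ : b₂ = b₁)
    (h₆ : b₁ = b₀) (h₇ : a₀ = a₃) (h₈ : b₃ = b₀) :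
    eqToHom h₁ ≫ (eqToHom h₂ ≫ (eqToHom h₃ ≫ φ ≫ eqToHom h₄) ≫ eqToHom h₅) ≫ eqToHom h₆ =
      eqToHom h₇ ≫ φ ≫ eqToHom h₈ := by
  simp

namespace Desc

/-- The morphism of `Y^n` that descent data attach to an edge of the simplex `[n]`. -/
def edge (x : Desc Y) {n : SimplexCategory} (e : ⦋1⦌ ⟶ n) {f g : ⦋0⦌ ⟶ n} (hf : δ 1 ≫ e = f)
    (hg : δ 0 ≫ e = g) : (Y.map f).obj x.a ⟶ (Y.map g).obj x.a :=
  eqToHom (map_obj_comp Y (δ 1) e hf x.a) ≫ (Y.map e).map x.α ≫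
    eqToHom (map_obj_comp Y (δ 0) e hg x.a).symm

/-- This is what makes the functors `simplexFunctor` compatible with the arrows of `Δ`. -/
lemma edge_eq_map_edge (x : Desc Y) {n m : SimplexCategory} {e : ⦋1⦌ ⟶ n} {f g : ⦋0⦌ ⟶ n}
    {hf : δ 1 ≫ e = f} {hg : δ 0 ≫ e = g} {t : n ⟶ m} {e' : ⦋1⦌ ⟶ m} {f' g' : ⦋0⦌ ⟶ m}
    {hf' : δ 1 ≫ e' = f'} {hg' : δ 0 ≫ e' = g'} (he : e ≫ t = e')
    (hft : f ≫ t = f') (hgt : g ≫ t = g') :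
    x.edge e' hf' hg' = eqToHom (map_obj_comp Y f t hft x.a) ≫ (Y.map t).map (x.edge e hf hg) ≫
      eqToHom (map_obj_comp Y g t hgt x.a).symm := by
  simp only [edge, Functor.map_comp, eqToHom_map, map_map_comp Y e t he x.α]
  simp

/-- The image of the unit condition under `f`; it yields preservation of identities. -/
lemma edge_degenerate (x : Desc Y) {n : SimplexCategory} {f : ⦋0⦌ ⟶ n} {e : ⦋1⦌ ⟶ n}
    (he : σ 0 ≫ f = e) (hf : δ 1 ≫ e = f) (hg : δ 0 ≫ e = f) :
    x.edge e hf hg = 𝟙 _ := by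
  have h := map_map_comp Y (σ 0) f he x.α
  rw [x.unit, eqToHom_map] at h
  rw [edge, (eqToHom_conj_eq_iff _ _ _ _).1 h.symm]
  simp

/-- The image of the cocycle condition under the triangle `t`; it yields preservation of
composition. -/
lemma edge_comp (x : Desc Y) {n : SimplexCategory} (t : ⦋2⦌ ⟶ n) {e₀ e₁ e₂ : ⦋1⦌ ⟶ n}
    (h₀ : δ 0 ≫ t = e₀) (h₁ : δ 1 ≫ t = e₁) (h₂ : δ 2 ≫ t = e₂) {f₀ f₁ f₂ : ⦋0⦌ ⟶ n}
    (h₂₁ : δ 1 ≫ e₂ = f₀) (h₂₀ : δ 0 ≫ e₂ = f₁) (h₀₁ : δ 1 ≫ e₀ = f₁) (h₀₀ : δ 0 ≫ e₀ = f₂)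
    (h₁₁ : δ 1 ≫ e₁ = f₀) (h₁₀ : δ 0 ≫ e₁ = f₂) :
    x.edge e₂ h₂₁ h₂₀ ≫ x.edge e₀ h₀₁ h₀₀ = x.edge e₁ h₁₁ h₁₀ := by
  have h := congrArg (Y.map t).map x.cocycle
  simp only [Functor.map_comp, eqToHom_map, map_map_comp Y _ t h₀, map_map_comp Y _ t h₁,
    map_map_comp Y _ t h₂, Category.assoc, eqToHom_trans, eqToHom_trans_assoc] at h
  simp only [edge, (eqToHom_conj_eq_iff _ _ _ _).1 h.symm]
  simp

lemma source_mkOfLe {n : SimplexCategory} {k l : Fin (n.len + 1)} (h : k ≤ l) :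
    δ 1 ≫ mkOfLe (n := n.len) k l h = const ⦋0⦌ n k := by
  ext i
  fin_cases i
  rfl

lemma target_mkOfLe {n : SimplexCategory} {k l : Fin (n.len + 1)} (h : k ≤ l) :
    δ 0 ≫ mkOfLe (n := n.len) k l h = const ⦋0⦌ n l := by
  ext i
  fin_cases i
  rfl

/-- The functor `[n] ⥤ Y^n` given by descent data. -/
def simplexFunctor (x : Desc Y) (n : SimplexCategory) : Fin (n.len + 1) ⥤ Y.obj n where
  obj k := (Y.map (const ⦋0⦌ n k)).obj x.a
  map {k l} h := x.edge (mkOfLe (n := n.len) k l (leOfHom h)) (source_mkOfLe _) (target_mkOfLe _)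
  map_id k := x.edge_degenerate (by ext i; fin_cases i <;> rfl) _ _
  map_comp {k l m} h h' := (x.edge_comp (mkOfLeComp (n := n.len) k l m (leOfHom h) (leOfHom h'))
    (by ext i; fin_cases i <;> rfl) (by ext i; fin_cases i <;> rfl)
    (by ext i; fin_cases i <;> rfl) _ _ _ _ _ _).symm

/-- The family of simplices given by descent data. -/
def toFam (x : Desc Y) (p q : SimplexCategory → Prop) : Fam toCat p q Y where
  fn n := x.simplexFunctor n.1
  comm a :=
    CategoryTheory.Functor.ext (fun (k : Fin (a.src.len + 1)) =>
      map_obj_comp Y (const ⦋0⦌ a.src k) a.hom rfl x.a)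
      (fun (k l : Fin (a.src.len + 1)) h =>
        x.edge_eq_map_edge (e := mkOfLe (n := a.src.len) k l (leOfHom h))
          (hf := source_mkOfLe (leOfHom h)) (hg := target_mkOfLe (leOfHom h))
          (t := a.hom) (hf' := source_mkOfLe (n := a.tgt) (a.hom.toOrderHom.monotone (leOfHom h)))
          (hg' := target_mkOfLe (n := a.tgt) (a.hom.toOrderHom.monotone (leOfHom h)))
          (by ext i; fin_cases i <;> rfl) rfl rfl)

end Desc

namespace Fam

variable {p q : SimplexCategory → Prop} 

/-- The member `[n] ⥤ Y^n` of a family of simplices. -/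
def simplex (F : Fam toCat p q Y) (n : SimplexCategory) (hn : p n) : Fin (n.len + 1) ⥤ Y.obj n :=
  F.fn ⟨n, hn⟩

lemma obj_eq (F : Fam toCat p q Y) {i j : SimplexCategory} (f : j ⟶ i) (hj : p j) (hj' : q j)
    (hi : p i) (k : Fin (j.len + 1)) {l : Fin (i.len + 1)} (hl : f.toOrderHom k = l) :
    (Y.map f).obj ((F.simplex j hj).obj k) = (F.simplex i hi).obj l := by
  subst hl
  exact (Functor.congr_obj (F.comm ⟨j, i, f, hj, hj', hi⟩) k).symm

lemma map_eq (F : Fam toCat p q Y) {i j : SimplexCategory} (f : j ⟶ i) (hj : p j) (hj' : q j)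
    (hi : p i) {k k' : Fin (j.len + 1)} (h : k ⟶ k') {l l' : Fin (i.len + 1)} (h' : l ⟶ l')
    (hl : f.toOrderHom k = l) (hl' : f.toOrderHom k' = l') :
    (Y.map f).map ((F.simplex j hj).map h) = eqToHom (F.obj_eq f hj hj' hi k hl) ≫
      (F.simplex i hi).map h' ≫ eqToHom (F.obj_eq f hj hj' hi k' hl').symm := by
  subst hl hl'
  exact Functor.congr_hom (F.comm ⟨j, i, f, hj, hj', hi⟩).symm h

/-- The descent data given by a family of simplices. -/
def toDesc (hp : ∀ n, n ≤ 2 → p ⦋n⦌) (hq : ∀ n, n ≤ 1 → q ⦋n⦌) (F : Fam toCat p q Y) :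
    Desc Y where
  a := (F.simplex ⦋0⦌ (hp 0 (by lia))).obj (0 : Fin 1)
  α := eqToHom (F.obj_eq (δ 1) (hp 0 (by lia)) (hq 0 (by lia)) (hp 1 (by lia)) (0 : Fin 1)
      (l := (0 : Fin 2)) rfl) ≫
    (F.simplex ⦋1⦌ (hp 1 (by lia))).map (homOfLE (by decide) : (0 : Fin 2) ⟶ 1) ≫
    eqToHom (F.obj_eq (δ 0) (hp 0 (by lia)) (hq 0 (by lia)) (hp 1 (by lia)) (0 : Fin 1)
      (l := (1 : Fin 2)) rfl).symm
  unit := by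
    simp only [Functor.map_comp, eqToHom_map]
    -- The degeneracy collapses the edge `0 ⟶ 1` to an identity of `[0]`.
    rw [F.map_eq (σ 0) (hp 1 (by lia)) (hq 1 (by lia)) (hp 0 (by lia)) _ (𝟙 (0 : Fin 1)) rfl rfl]
    simp
  cocycle := by
    simp only [Functor.map_comp, eqToHom_map]
    -- The three cofaces `[1] ⟶ [2]` turn the cocycle condition into functoriality on `0 ⟶ 1 ⟶ 2`.
    -- Dimension 2 is used only as a target, so `q` is needed only up to 1.
    rw [F.map_eq (δ 0) (hp 1 (by lia)) (hq 1 (by lia)) (hp 2 (by lia)) _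
        (homOfLE (by decide) : (1 : Fin 3) ⟶ 2) rfl rfl,
      F.map_eq (δ 1) (hp 1 (by lia)) (hq 1 (by lia)) (hp 2 (by lia)) _
        ((homOfLE (by decide) : (0 : Fin 3) ⟶ 1) ≫ (homOfLE (by decide) : (1 : Fin 3) ⟶ 2)) rfl rfl,
      F.map_eq (δ 2) (hp 1 (by lia)) (hq 1 (by lia)) (hp 2 (by lia)) _
        (homOfLE (by decide) : (0 : Fin 3) ⟶ 1) rfl rfl]
    simp only [Functor.map_comp, Category.assoc, eqToHom_trans_assoc, eqToHom_refl,
      Category.id_comp, eqToHom_trans]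

variable (hp : ∀ n, n ≤ 2 → p ⦋n⦌) (hq : ∀ n, n ≤ 1 → q ⦋n⦌)

lemma toDesc_map (g : Y ⟶ Y') (F : Fam toCat p q Y) :
    (F.map g).toDesc hp hq = Desc.mapObj g (F.toDesc hp hq) := by
  refine Desc.ext' rfl ?_
  exact map_eqToHom_aux (A := Y.obj ⦋1⦌) (B := Y'.obj ⦋1⦌) (g.app ⦋1⦌)
    ((F.simplex ⦋1⦌ (hp 1 (by lia))).map (homOfLE (by decide) : (0 : Fin 2) ⟶ 1)) _ _ _ _ _ _ _ _

/-- Vertices and edges of `[n]` are images of arrows from `[0]` and `[1]`, and compatibility with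
these arrows forces the values of the family. All other members and arrows are redundant. -/
lemma toFam_toDesc (F : Fam toCat p q Y) : (F.toDesc hp hq).toFam p q = F := by
  ext n : 2
  refine CategoryTheory.Functor.ext (fun (k : Fin (n.1.len + 1)) => ?_)
    (fun (k l : Fin (n.1.len + 1)) h => ?_)
  · exact F.obj_eq _ _ (hq 0 (by lia)) _ _ rfl
  · change Desc.edge _ _ (Desc.source_mkOfLe (leOfHom h)) (Desc.target_mkOfLe (leOfHom h)) =
      eqToHom _ ≫ (F.simplex n.1 n.2).map h ≫ eqToHom _
    dsimp only [Desc.edge, toDesc]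
    simp only [Functor.map_comp, eqToHom_map]
    rw [F.map_eq _ (hp 1 (by lia)) (hq 1 (by lia)) n.2 _ h rfl rfl]
    simp

lemma toDesc_toFam (x : Desc Y) : (x.toFam p q).toDesc hp hq = x := by
  have h₀ : const ⦋0⦌ ⦋0⦌ 0 = 𝟙 _ := by ext i; fin_cases i; rfl
  have h₁ (e : ⦋1⦌ ⟶ ⦋1⦌) (he : e = 𝟙 _) : (Y.map e).map x.α = eqToHom (by rw [he, Y.map_id]; rfl) ≫
      x.α ≫ eqToHom (by rw [he, Y.map_id]; rfl) := by
    subst he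
    exact Functor.congr_hom (Y.map_id _) x.α
  refine Desc.ext' ?_ ?_
  · exact (congrArg (fun t => (Y.map t).obj x.a) h₀).trans (Functor.congr_obj (Y.map_id _) x.a)
  · change eqToHom _ ≫ Desc.edge _ _ (Desc.source_mkOfLe (n := ⦋1⦌) (k := 0) (l := 1) (by decide))
      (Desc.target_mkOfLe _) ≫ eqToHom _ = _
    rw [Desc.edge, h₁ _ (by ext i; fin_cases i <;> rfl)]
    exact eqToHom_conj_conj_conj x.α _ _ _ _ _ _ _ _

end Fam

/-- Families of simplices are descent data. -/
def descEquivFam {p q : SimplexCategory → Prop} (hp : ∀ n, n ≤ 2 → p ⦋n⦌)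
    (hq : ∀ n, n ≤ 1 → q ⦋n⦌) (Y : SimplexCategory ⥤ Grpd.{v, v}) : Desc Y ≃ Fam toCat p q Y where
  toFun x := x.toFam p q
  invFun F := F.toDesc hp hq
  left_inv x := Fam.toDesc_toFam hp hq x
  right_inv F := Fam.toFam_toDesc hp hq F

end DescFam

/-! ### Comparison of the equalizers with the homotopy limit -/

section Comparison

open SimplexCategory

/-- Naturality passes from `Fam.toDesc` to its inverse. -/
lemma Desc.toFam_mapObj {Y Y' : SimplexCategory ⥤ Grpd.{v, v}} {p q : SimplexCategory → Prop}
    (hp : ∀ n, n ≤ 2 → p ⦋n⦌) (hq : ∀ n, n ≤ 1 → q ⦋n⦌) (g : Y ⟶ Y') (x : Desc Y) :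
    (Desc.mapObj g x).toFam p q = (x.toFam p q).map g := by
  rw [← Fam.toFam_toDesc hp hq ((x.toFam p q).map g), Fam.toDesc_map, Fam.toDesc_toFam]

/-- The map from truncated families of simplices to families on the categories `Δ/n`. -/
def famTruncOver {p q : SimplexCategory → Prop} (hp : ∀ n, n ≤ 2 → p ⦋n⦌)
    (hq : ∀ n, n ≤ 1 → q ⦋n⦌) : FamHom.{v} toCat (Over.mapFunctor SimplexCategory) p q
      (fun _ => True) (fun _ => True) where
  app F := famOver.app ((F.toDesc hp hq).toFam (fun _ => True) (fun _ => True))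
  naturality g F := by
    rw [Fam.toDesc_map, Desc.toFam_mapObj (fun _ _ => trivial) (fun _ _ => trivial),
      famOver.naturality]

/-- The map from families on the categories `Δ/n` to truncated families of simplices. -/
def famOverTrunc (p q : SimplexCategory → Prop) :
    FamHom.{v} (Over.mapFunctor SimplexCategory) toCat (fun _ => True) (fun _ => True) p q where
  app F := (famSimplex.app F).restrict (fun _ _ => trivial) (fun _ _ => trivial)
  naturality g F := by
    rw [famSimplex.naturality]
    rfl

section

variable {Y : SimplexCategory ⥤ Grpd.{v, v}} {p q : SimplexCategory → Prop}
  (hp : ∀ n, n ≤ 2 → p ⦋n⦌) (hq : ∀ n, n ≤ 1 → q ⦋n⦌)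

lemma famOverTrunc_famTruncOver (F : Fam toCat p q Y) :
    (famOverTrunc p q).app ((famTruncOver hp hq).app F) = F := by
  dsimp only [famOverTrunc, famTruncOver]
  rw [famSimplex_famOver]
  exact Fam.toFam_toDesc hp hq F

/-- The full family of simplices is recovered from its truncation, so what remains is the last
vertex round trip that `famPath` contracts. -/
lemma famTruncOver_famOverTrunc
    (F : Fam (Over.mapFunctor SimplexCategory) (fun _ => True) (fun _ => True) Y) :
    (famTruncOver hp hq).app ((famOverTrunc p q).app F) = famOver.app (famSimplex.app F) :=
  congrArg famOver.app
    (Fam.toFam_toDesc (fun _ _ => trivial) (fun _ _ => trivial) (famSimplex.app F))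

end

variable {C : Type u} [Category.{v} C] {P : SSet.{v}ᵒᵖ ⥤ C ⥤ C} (R : GrpdRepr P)
  [HasProducts.{0} C] [HasEqualizers C]

/-- The comparison map from the equalizer to the homotopy limit. -/
def toHolim : truncTot P 2 1 ⟶ holim (I := SimplexCategory) P :=
  eqzTrans R simplexWeight (overWeight _) (famTruncOver (fun _ h => h) (fun _ h => h))

/-- The homotopy inverse of the comparison map. -/
def ofHolim : holim (I := SimplexCategory) P ⟶ truncTot P 2 1 :=
  eqzTrans R (overWeight _) simplexWeight (famOverTrunc _ _)

lemma toHolim_ofHolim (X : SimplexCategory ⥤ C) :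
    (toHolim R).app X ≫ (ofHolim R).app X = 𝟙 _ := by
  apply (homFam R simplexWeight X _).injective
  refine (homFam_eqzTrans R _ _ _ _).trans ?_
  -- The inserted identity lets `homFam_eqzTrans` apply to the first map as well.
  rw [← Category.id_comp ((toHolim R).app X)]
  refine (congrArg _ (homFam_eqzTrans R _ _ _ _)).trans ?_
  exact famOverTrunc_famTruncOver _ _ _

lemma exists_cyl_ofHolim_toHolim (X : SimplexCategory ⥤ C) :
    ∃ h : R.cyl ((holim P).obj X) ⟶ (holim P).obj X,
      R.ι false _ ≫ h = (ofHolim R).app X ≫ (toHolim R).app X ∧ R.ι true _ ≫ h = 𝟙 _ := by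
  refine exists_cyl_of_fam R (overWeight _) _ _ (famPath (homFam R (overWeight _) X _ (𝟙 _))) ?_ ?_
  · rw [famPath_false]
    refine Eq.trans ?_ (homFam_eqzTrans R _ _ _ _).symm
    rw [← Category.id_comp ((ofHolim R).app X)]
    refine Eq.trans ?_ (congrArg _ (homFam_eqzTrans R _ _ _ _)).symm
    exact (famTruncOver_famOverTrunc _ _ _).symm
  · exact famPath_true _

/-- Maps to the truncated totalization are descent data. -/
def truncTotEquiv {n m : ℕ} (hn : 2 ≤ n) (hm : 1 ≤ m) (X : SimplexCategory ⥤ C) (B : C) :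
    (B ⟶ (truncTot P n m).obj X) ≃ Desc (X ⋙ R.hom.obj (op B)) :=
  (homFam R simplexWeight X B).trans
    (descEquivFam (fun _ h => h.trans hn) (fun _ h => h.trans hm) _).symm

lemma truncTotEquiv_precomp {n m : ℕ} (hn : 2 ≤ n) (hm : 1 ≤ m) (X : SimplexCategory ⥤ C)
    {B B' : C} (b : B' ⟶ B) (f : B ⟶ (truncTot P n m).obj X) :
    truncTotEquiv R hn hm X B' (b ≫ f) =
      Desc.mapObj (Functor.whiskerLeft X (R.hom.map b.op)) (truncTotEquiv R hn hm X B f) := by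
  refine Eq.trans ?_ (Fam.toDesc_map (fun _ h => h.trans hn) (fun _ h => h.trans hm) _ _)
  exact congrArg (Fam.toDesc _ _) (homFam_precomp R simplexWeight X b f)

lemma truncTotEquiv_postcomp {n m : ℕ} (hn : 2 ≤ n) (hm : 1 ≤ m) {X X' : SimplexCategory ⥤ C}
    (x : X ⟶ X') {B : C} (f : B ⟶ (truncTot P n m).obj X) :
    truncTotEquiv R hn hm X' B (f ≫ (truncTot P n m).map x) =
      Desc.mapObj (Functor.whiskerRight x (R.hom.obj (op B))) (truncTotEquiv R hn hm X B f) := by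
  refine Eq.trans ?_ (Fam.toDesc_map (fun _ h => h.trans hn) (fun _ h => h.trans hm) _ _)
  exact congrArg (Fam.toDesc _ _) (homFam_postcomp R simplexWeight x f)

/-- Functors with naturally equivalent sets of generalized elements are isomorphic. -/
def isoOfHomEquiv {D : Type u'} [Category.{v'} D] {F G : D ⥤ C}
    (e : ∀ X B, (B ⟶ F.obj X) ≃ (B ⟶ G.obj X))
    (he : ∀ {X B B'} (b : B' ⟶ B) (f : B ⟶ F.obj X), e X B' (b ≫ f) = b ≫ e X B f)
    (he' : ∀ {X X' B} (x : X ⟶ X') (f : B ⟶ F.obj X), e X' B (f ≫ F.map x) = e X B f ≫ G.map x) :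
    F ≅ G :=
  NatIso.ofComponents (fun X =>
    { hom := e X _ (𝟙 _)
      inv := (e X _).symm (𝟙 _)
      hom_inv_id := (e X _).injective (by rw [he, Equiv.apply_symm_apply, Category.comp_id])
      inv_hom_id := by rw [← he, Category.comp_id, Equiv.apply_symm_apply] })
    (fun {X X'} x => by
      dsimp only
      rw [← he, ← he', Category.id_comp, Category.comp_id])

/-- The truncated totalizations are isomorphic. -/
def truncTotIso {n m n' m' : ℕ} (hn : 2 ≤ n) (hm : 1 ≤ m) (hn' : 2 ≤ n') (hm' : 1 ≤ m') :
    truncTot P n m ≅ truncTot P n' m' :=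
  isoOfHomEquiv (fun X B => (truncTotEquiv R hn hm X B).trans (truncTotEquiv R hn' hm' X B).symm)
    (fun b f => by
      rw [Equiv.trans_apply, Equiv.symm_apply_eq, truncTotEquiv_precomp, truncTotEquiv_precomp,
        Equiv.trans_apply, Equiv.apply_symm_apply])
    (fun x f => by
      rw [Equiv.trans_apply, Equiv.symm_apply_eq, truncTotEquiv_postcomp, truncTotEquiv_postcomp,
        Equiv.trans_apply, Equiv.apply_symm_apply])

lemma truncTotIso_hom_ι {n m m' : ℕ} (hn : 2 ≤ n) (hm : 1 ≤ m) (hm' : 1 ≤ m')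
    (X : SimplexCategory ⥤ C) :
    (truncTotIso R hn hm hn hm').hom.app X ≫ truncTotι P n m' X = truncTotι P n m X := by
  refine Pi.hom_ext _ _ fun i => ?_
  apply (weightEquiv R simplexWeight i.1 (X.obj i.1) _).injective
  let F := homFam R simplexWeight X _ (𝟙 ((truncTot P n m).obj X))
  -- The families in `h` and `h'` have the same functors and differ only in the arrows with which
  -- they must be compatible, so their components can be compared directly.
  have h : homFam R simplexWeight X _ ((truncTotIso R hn hm hn hm').hom.app X) =
      (F.toDesc (fun _ h => h.trans hn) (fun _ h => h.trans hm)).toFam _ _ :=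
    (homFam R simplexWeight X _).apply_symm_apply _
  have h' : (F.toDesc (fun _ h => h.trans hn) (fun _ h => h.trans hm)).toFam _ _ = F :=
    Fam.toFam_toDesc _ _ _
  rw [Category.assoc]
  refine (congrArg (fun t => t.fn i) h).trans ((congrArg (fun t => t.fn i) h').trans ?_)
  exact congrArg (weightEquiv R simplexWeight i.1 (X.obj i.1) _)
    (Category.id_comp (truncTotι P n m X ≫ Pi.π _ i))

end Comparison

/-! ### Cosimplicial groupoids -/

section GroupoidCase

open SimplexCategory

/-- Interchange of the variables of a functor of two variables. -/
def flipEquiv (B K A : Grpd.{v, v}) :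
    (B ⟶ (grpdFun.obj (op K)).obj A) ≃ (K ⟶ (grpdFun.obj (op B)).obj A) where
  toFun F := (Functor.flip F : K ⥤ B ⥤ A)
  invFun F := (Functor.flip F : B ⥤ K ⥤ A)
  left_inv _ := rfl
  right_inv _ := rfl

lemma functor_functor_ext {D : Type u'} [Category.{v'} D] {K : Type v} [Category.{v} K]
    {A : Type u} [Category.{w} A] {F G : D ⥤ K ⥤ A}
    (hobj : ∀ d k, (F.obj d).obj k = (G.obj d).obj k)
    (hmap : ∀ (d : D) {k k' : K} (f : k ⟶ k'), (F.obj d).map f = eqToHom (hobj d k) ≫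
      (G.obj d).map f ≫ eqToHom (hobj d k').symm)
    (happ : ∀ {d d' : D} (g : d ⟶ d') (k : K), (F.map g).app k = eqToHom (hobj d k) ≫
      (G.map g).app k ≫ eqToHom (hobj d' k).symm) : F = G := by
  refine CategoryTheory.Functor.ext
    (fun d => CategoryTheory.Functor.ext (hobj d) (fun _ _ f => hmap d f)) (fun d d' g => ?_)
  ext k
  rw [happ, NatTrans.comp_app, NatTrans.comp_app, eqToHom_app, eqToHom_app]

/-- Lets the unit and cocycle conditions in a functor groupoid be read pointwise. -/
lemma grpdFun_eqToHom_app {B G : Grpd.{v, v}} {F F' : (grpdFun.obj (op B)).obj G} (h : F = F')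
    (b : B) : NatTrans.app (F := (F : B ⥤ G)) (G := (F' : B ⥤ G)) (eqToHom h) b =
      eqToHom (congrArg (fun t : B ⥤ G => t.obj b) h) := by
  subst h
  rfl

lemma flipEquiv_precomp {B B' K A : Grpd.{v, v}} (b : B' ⟶ B)
    (f : B ⟶ (grpdFun.obj (op K)).obj A) :
    flipEquiv B' K A (b ≫ f) = flipEquiv B K A f ≫ (grpdFun.map b.op).app A :=
  rfl

lemma flipEquiv_map {B K A A' : Grpd.{v, v}} (a : A ⟶ A')
    (f : B ⟶ (grpdFun.obj (op K)).obj A) :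
    flipEquiv B K A' (f ≫ (grpdFun.obj (op K)).map a) =
      flipEquiv B K A f ≫ (grpdFun.obj (op B)).map a :=
  rfl

lemma flipEquiv_weight {B K K' A : Grpd.{v, v}} (κ : K' ⟶ K)
    (f : B ⟶ (grpdFun.obj (op K)).obj A) :
    flipEquiv B K' A (f ≫ (grpdFun.map κ.op).app A) = κ ≫ flipEquiv B K A f :=
  rfl

/-- Functor groupoids represent the cotensors of groupoids. -/
def grpdPowRepr : GrpdRepr grpdPow.{v} where
  hom := grpdFun
  powEquiv K A B := (flipEquiv B (fundGrpd.obj K) A).trans (fundGrpdAdj.homEquiv K _)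
  powEquiv_precomp {K A B B'} b f :=
    (congrArg (fundGrpdAdj.homEquiv K _) (flipEquiv_precomp b f)).trans
      (fundGrpdAdj.homEquiv_naturality_right (flipEquiv B (fundGrpd.obj K) A f)
        ((grpdFun.map b.op).app A))
  powEquiv_map {K A A' B} a f :=
    (congrArg (fundGrpdAdj.homEquiv K _) (flipEquiv_map a f)).trans
      (fundGrpdAdj.homEquiv_naturality_right (flipEquiv B (fundGrpd.obj K) A f)
        ((grpdFun.obj (op B)).map a))
  powEquiv_weight {K K' A B} κ f :=
    (congrArg (fundGrpdAdj.homEquiv K' _) (flipEquiv_weight (fundGrpd.map κ) f)).trans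
      (fundGrpdAdj.homEquiv_naturality_left κ (flipEquiv B (fundGrpd.obj K) A f))
  cyl B := Grpd.of (interval.{v} × B)
  ι b B := (Functor.prod' ((Functor.const B).obj (interval.pt b)) (𝟭 B) : B ⥤ interval.{v} × B)
  cylLift B :=
    { app A := (Functor.uncurry : (interval.{v} ⥤ B ⥤ A) ⥤ interval.{v} × B ⥤ A)
      naturality A A' a := by
        refine functor_functor_ext (D := interval.{v} ⥤ B ⥤ A) (K := interval.{v} × B) (A := A')
          (fun _ _ => rfl) (fun F k k' f => ?_) (fun _ _ => ?_)
        · change (a : A ⥤ A').map _ ≫ (a : A ⥤ A').map _ =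
            𝟙 _ ≫ (a : A ⥤ A').map (_ ≫ _) ≫ 𝟙 _
          rw [Category.id_comp, Category.comp_id, Functor.map_comp]
        · exact ((Category.id_comp _).trans (Category.comp_id _)).symm }
  cylLift_ι b B A := by
    refine functor_functor_ext (D := interval.{v} ⥤ B ⥤ A) (K := B) (A := A) (fun _ _ => rfl)
      (fun F x y f => ?_) (fun _ _ => ?_)
    · change (F.map (𝟙 _)).app x ≫ (F.obj _).map f = 𝟙 _ ≫ (F.obj _).map f ≫ 𝟙 _
      simp
    · exact ((Category.id_comp _).trans (Category.comp_id _)).symm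

variable {X X' : SimplexCategory ⥤ Grpd.{v, v}}

/-- Functors to the descent groupoid are descent data in functor groupoids. -/
def functorDescEquiv (X : SimplexCategory ⥤ Grpd.{v, v}) (B : Grpd.{v, v}) :
    (B ⟶ descFunctor.obj X) ≃ Desc (X ⋙ grpdFun.obj (op B)) where
  toFun (T : B ⥤ Desc X) :=
    { a := ({ obj b := (T.obj b).a
              map f := (T.map f).β
              map_id b := congrArg Desc.Hom.β (T.map_id b)
              map_comp f g := congrArg Desc.Hom.β (T.map_comp f g) } : B ⥤ X.obj ⦋0⦌)
      -- The condition on morphisms of descent data is precisely the naturality of this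
      -- transformation.
      α := { app b := (T.obj b).α
             naturality b b' f := (T.map f).comm }
      unit := by
        refine NatTrans.ext (funext fun b => ?_)
        exact Eq.trans (T.obj b).unit (Eq.symm (by exact grpdFun_eqToHom_app (G := X.obj ⦋0⦌) _ b))
      cocycle := by
        refine NatTrans.ext (funext fun b => ?_)
        refine Eq.trans ?_ ((T.obj b).cocycle.trans ?_)
        · exact congrArg (fun t => (X.map (δ 2)).map (T.obj b).α ≫ t ≫
            (X.map (δ 0)).map (T.obj b).α) (grpdFun_eqToHom_app (G := X.obj ⦋2⦌) _ b)
        · exact (congrArg₂ (fun s t => s ≫ (X.map (δ 1)).map (T.obj b).α ≫ t)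
            (grpdFun_eqToHom_app (G := X.obj ⦋2⦌) _ b) (grpdFun_eqToHom_app (G := X.obj ⦋2⦌) _ b)).symm }
  invFun x :=
    ({ obj b :=
        { a := (x.a : B ⥤ X.obj ⦋0⦌).obj b
          α := NatTrans.app x.α b
          unit := (congrArg (fun t => NatTrans.app t b) x.unit).trans
            (grpdFun_eqToHom_app (G := X.obj ⦋0⦌) _ b)
          cocycle := by
            refine Eq.trans ?_ ((congrArg (fun t => NatTrans.app t b) x.cocycle).trans ?_)
            · exact (congrArg (fun t => (X.map (δ 2)).map (NatTrans.app x.α b) ≫ t ≫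
                (X.map (δ 0)).map (NatTrans.app x.α b)) (grpdFun_eqToHom_app (G := X.obj ⦋2⦌) _ b)).symm
            · exact congrArg₂ (fun s t => s ≫ (X.map (δ 1)).map (NatTrans.app x.α b) ≫ t)
                (grpdFun_eqToHom_app (G := X.obj ⦋2⦌) _ b) (grpdFun_eqToHom_app (G := X.obj ⦋2⦌) _ b) }
       map {b b'} f := 
        { β := (x.a : B ⥤ X.obj ⦋0⦌).map f
          comm := NatTrans.naturality x.α f }
       map_id b := Desc.Hom.ext ((x.a : B ⥤ X.obj ⦋0⦌).map_id b)
       map_comp f g := Desc.Hom.ext ((x.a : B ⥤ X.obj ⦋0⦌).map_comp f g) } : B ⥤ Desc X)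
  left_inv _ := rfl
  right_inv _ := rfl

lemma functorDescEquiv_precomp {B B' : Grpd.{v, v}} (b : B' ⟶ B) (T : B ⟶ descFunctor.obj X) :
    functorDescEquiv X B' (b ≫ T) =
      Desc.mapObj (Functor.whiskerLeft X (grpdFun.map b.op)) (functorDescEquiv X B T) := by
  refine Desc.ext' rfl (NatTrans.ext (funext fun c => ?_))
  refine Eq.trans ?_ ((Category.id_comp _).trans (Category.comp_id _)).symm
  exact ((Category.id_comp _).trans (Category.comp_id _)).symm

lemma functorDescEquiv_postcomp {B : Grpd.{v, v}} (x : X ⟶ X') (T : B ⟶ descFunctor.obj X) :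
    functorDescEquiv X' B (T ≫ descFunctor.map x) =
      Desc.mapObj (Functor.whiskerRight x (grpdFun.obj (op B))) (functorDescEquiv X B T) := by
  refine Desc.ext' rfl (NatTrans.ext (funext fun c => ?_))
  refine Eq.trans ?_ ((Category.id_comp _).trans (Category.comp_id _)).symm
  refine (congrArg₂ (fun s t => s ≫ (x.app ⦋1⦌).map (T.obj c).α ≫ t) ?_ ?_)
  · exact Eq.symm (by exact grpdFun_eqToHom_app (G := X'.obj ⦋1⦌) _ c)
  · exact Eq.symm (by exact grpdFun_eqToHom_app (G := X'.obj ⦋1⦌) _ c)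

/-- Maps to the truncated totalization of a cosimplicial groupoid are descent data. -/
def truncTotGrpdEquiv {n m : ℕ} (hn : 2 ≤ n) (hm : 1 ≤ m) (X : SimplexCategory ⥤ Grpd.{v, v})
    (B : Grpd.{v, v}) : (B ⟶ (truncTot grpdPow n m).obj X) ≃ Desc (X ⋙ grpdFun.obj (op B)) :=
  truncTotEquiv grpdPowRepr hn hm X B

/-- The descent groupoid is the truncated totalization. -/
def descIso {n m : ℕ} (hn : 2 ≤ n) (hm : 1 ≤ m) : descFunctor.{v} ≅ truncTot grpdPow.{v} n m :=
  isoOfHomEquiv (fun X B => (functorDescEquiv X B).trans (truncTotGrpdEquiv hn hm X B).symm)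
    (fun {X B B'} b f => by
      rw [Equiv.trans_apply, Equiv.symm_apply_eq, functorDescEquiv_precomp, Equiv.trans_apply]
      refine Eq.trans ?_ (truncTotEquiv_precomp grpdPowRepr hn hm X b _).symm
      exact congrArg _ ((truncTotGrpdEquiv hn hm X B).apply_symm_apply _).symm)
    (fun {X X' B} x f => by
      rw [Equiv.trans_apply, Equiv.symm_apply_eq, functorDescEquiv_postcomp, Equiv.trans_apply]
      refine Eq.trans ?_ (truncTotEquiv_postcomp grpdPowRepr hn hm x _).symm
      exact congrArg _ ((truncTotGrpdEquiv hn hm X B).apply_symm_apply _).symm)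

/-- A homotopy of functors is a natural isomorphism. -/
lemma nonempty_iso_of_cyl {B A : Grpd.{v, v}} (f₀ f₁ : (B : Type v) ⥤ A)
    (h : grpdPowRepr.cyl B ⟶ A) (h₀ : grpdPowRepr.ι false B ≫ h = f₀)
    (h₁ : grpdPowRepr.ι true B ≫ h = f₁) : Nonempty (f₀ ≅ f₁) := by
  subst h₀ h₁
  let H : interval.{v} ⥤ B ⥤ A := Functor.curry.obj (h : interval.{v} × B ⥤ A)
  have e (b : Bool) : (grpdPowRepr.ι b B ⋙ h : B ⥤ A) ≅ H.obj (interval.pt b) :=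
    NatIso.ofComponents (fun _ => Iso.refl _) (fun f =>
      (Category.comp_id _).trans (Category.id_comp _).symm)
  -- After currying, the homotopy is a functor on the interval, and it sends the invertible arrow
  -- there to a natural isomorphism.
  exact ⟨e false ≪≫ H.mapIso (asIso interval.arrow) ≪≫ (e true).symm⟩

lemma isEquivalence_toHolim (X : SimplexCategory ⥤ Grpd.{v, v}) :
    Functor.IsEquivalence ((toHolim grpdPowRepr).app X) := by
  obtain ⟨h, h₀, h₁⟩ := exists_cyl_ofHolim_toHolim grpdPowRepr X
  obtain ⟨e⟩ := nonempty_iso_of_cyl _ (𝟭 _) h h₀ h₁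
  exact (CategoryTheory.Equivalence.mk ((toHolim grpdPowRepr).app X) ((ofHolim grpdPowRepr).app X)
    (eqToIso (toHolim_ofHolim grpdPowRepr X).symm) e).isEquivalence_functor

end GroupoidCase

/-! ### Cotensors, and tensors with the interval -/

section Tensors

/-! ### Whiskering over a cartesian base -/

section Whisker

variable {V : Type u'} [Category.{v'} V] [CartesianMonoidalCategory V]
  {D : Type u} [Category.{v} D] [EnrichedOrdinaryCategory V D]

lemma eHomWhiskerRight_eq_lift {A B : D} (f : A ⟶ B) (Z : D) : eHomWhiskerRight V f Z =
    lift (toUnit _ ≫ eHomEquiv V f) (𝟙 _) ≫ eComp V A B Z := by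
  rw [eHomWhiskerRight, ← Category.assoc]
  congr 1
  ext <;> simp

lemma eHomWhiskerLeft_eq_lift (Z : D) {A B : D} (f : A ⟶ B) : eHomWhiskerLeft V Z f =
    lift (𝟙 _) (toUnit _ ≫ eHomEquiv V f) ≫ eComp V Z A B := by
  rw [eHomWhiskerLeft, ← Category.assoc]
  congr 1
  ext <;> simp

lemma eHomEquiv_whiskerLeft {A B Z : D} (f : A ⟶ B) (g : B ⟶ Z) :
    eHomEquiv V f ≫ eHomWhiskerLeft V A g = eHomEquiv V (f ≫ g) := by
  rw [eHomWhiskerLeft_eq_lift, eHomEquiv_comp, ← Category.assoc, ← Category.assoc]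
  congr 1
  ext
  · simp
  · simp only [comp_lift, lift_snd, Category.assoc]
    simp

lemma eHomEquiv_whiskerRight {A B Z : D} (f : A ⟶ B) (g : B ⟶ Z) :
    eHomEquiv V g ≫ eHomWhiskerRight V f Z = eHomEquiv V (f ≫ g) := by
  rw [eHomWhiskerRight_eq_lift, eHomEquiv_comp, ← Category.assoc, ← Category.assoc]
  congr 1
  ext
  · simp only [comp_lift, lift_fst, Category.assoc]
    simp
  · simp

end Whisker

/-! ### Maps into cotensors -/

section Cotensor

variable {V : Type u'} [Category.{v'} V] [MonoidalCategory V] {D : Type u} [Category.{v} D]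
  [EnrichedOrdinaryCategory V D] [TensoredCotensored V D]

/-- Maps `B ⟶ A^K` are maps `K ⟶ Hom(B, A)`. -/
def powHomEquiv (K : V) (A B : D) : (B ⟶ pow V K A) ≃ (K ⟶ (B ⟶[V] A)) where
  toFun f := powEv V K A ≫ eHomWhiskerRight V f A
  invFun := powLift
  left_inv _ := pow_hom_ext (powEv_powLift _)
  right_inv := powEv_powLift

lemma powHomEquiv_precomp {K : V} {A B B' : D} (b : B' ⟶ B) (f : B ⟶ pow V K A) :
    powHomEquiv K A B' (b ≫ f) = powHomEquiv K A B f ≫ eHomWhiskerRight V b A := by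
  change powEv V K A ≫ eHomWhiskerRight V (b ≫ f) A =
    (powEv V K A ≫ eHomWhiskerRight V f A) ≫ eHomWhiskerRight V b A
  rw [eHomWhiskerRight_comp, Category.assoc]

lemma powHomEquiv_powMap {K K' : V} {A A' B : D} (κ : K' ⟶ K) (a : A ⟶ A') (f : B ⟶ pow V K A) :
    powHomEquiv K' A' B (f ≫ powMap κ a) =
      κ ≫ powHomEquiv K A B f ≫ eHomWhiskerLeft V B a := by
  change powEv V K' A' ≫ eHomWhiskerRight V (f ≫ powMap κ a) A' =
    κ ≫ (powEv V K A ≫ eHomWhiskerRight V f A) ≫ eHomWhiskerLeft V B a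
  rw [eHomWhiskerRight_comp, reassoc_of% powEv_powMap, eHom_whisker_exchange, Category.assoc]

end Cotensor

/-! ### Maps out of tensors -/

section Tensor

variable {V : Type u'} [Category.{v'} V] [CartesianMonoidalCategory V] {D : Type u} [Category.{v} D]
  [EnrichedOrdinaryCategory V D] [TensoredCotensored V D]

lemma ten_bijective (K : V) (A B : D) (L : V) : Function.Bijective
    (fun f : L ⟶ (ten V K A ⟶[V] B) =>
      ((tenCoev V K A ⊗ₘ f) ≫ eComp V A (ten V K A) B : K ⊗ L ⟶ (A ⟶[V] B))) :=
  (TensoredCotensored.tensor K A : Tensor V K A).bijective B L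

lemma tenCoev_whisker {K : V} {A B : D} (f : ten V K A ⟶ B) :
    tenCoev V K A ≫ eHomWhiskerLeft V A f =
      (ρ_ K).inv ≫ (tenCoev V K A ⊗ₘ eHomEquiv V f) ≫ eComp V A (ten V K A) B := by
  rw [eHomWhiskerLeft, rightUnitor_inv_naturality_assoc, MonoidalCategory.tensorHom_def,
    Category.assoc]

/-- Maps `A ⊗ K ⟶ B` are maps `K ⟶ Hom(A, B)`. -/
def tenHomEquiv (K : V) (A B : D) : (ten V K A ⟶ B) ≃ (K ⟶ (A ⟶[V] B)) :=
  ((eHomEquiv V).trans (Equiv.ofBijective _ (ten_bijective K A B (𝟙_ V)))).trans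
    ((ρ_ K).homFromEquiv)

lemma tenHomEquiv_apply {K : V} {A B : D} (f : ten V K A ⟶ B) :
    tenHomEquiv K A B f = tenCoev V K A ≫ eHomWhiskerLeft V A f :=
  (tenCoev_whisker f).symm

lemma tenHomEquiv_postcomp {K : V} {A B B' : D} (f : ten V K A ⟶ B) (g : B ⟶ B') :
    tenHomEquiv K A B' (f ≫ g) = tenHomEquiv K A B f ≫ eHomWhiskerLeft V A g := by
  rw [tenHomEquiv_apply, tenHomEquiv_apply, eHomWhiskerLeft_comp, Category.assoc]

/-- The map `A ⟶ A ⊗ K` given by a point of `K`. -/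
def tenPt {K : V} (x : 𝟙_ V ⟶ K) (A : D) : A ⟶ ten V K A :=
  (eHomEquiv V).symm (x ≫ tenCoev V K A)

lemma eHomEquiv_tenPt_comp {K : V} (x : 𝟙_ V ⟶ K) {A B : D} (f : ten V K A ⟶ B) :
    eHomEquiv V (tenPt x A ≫ f) = x ≫ tenHomEquiv K A B f := by
  rw [← eHomEquiv_whiskerLeft, tenPt, Equiv.apply_symm_apply, tenHomEquiv_apply, Category.assoc]

end Tensor

/-! ### Paths in hom groupoids and the tensor with the interval -/

/-- The evaluation functor `interval × Fun(interval, G) ⥤ G`. -/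
def pathEval (G : Grpd.{v, v}) : interval ⊗ grpdPath.obj G ⟶ G :=
  (evaluationUncurried interval.{v} G : interval.{v} × (interval.{v} ⥤ G) ⥤ G)

lemma pathEval_natural {G G' : Grpd.{v, v}} (g : G ⟶ G') :
    interval ◁ grpdPath.map g ≫ pathEval G' = pathEval G ≫ g := by
  refine CategoryTheory.Functor.ext (fun _ => rfl) (fun x y f => ?_)
  change _ = 𝟙 _ ≫ (g : G ⥤ G').map _ ≫ 𝟙 _
  rw [Category.id_comp, Category.comp_id]
  exact ((g : G ⥤ G').map_comp _ _).symm

/-- The inclusion of an endpoint of the interval. -/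
def intervalPt (b : Bool) : 𝟙_ Grpd.{v, v} ⟶ interval :=
  ((Functor.const (Discrete PUnit)).obj (interval.pt b) : Discrete PUnit.{v + 1} ⥤ interval.{v})

lemma intervalPt_pathEval (b : Bool) (G : Grpd.{v, v}) :
    (λ_ _).inv ≫ intervalPt b ▷ grpdPath.obj G ≫ pathEval G = (grpdPathEnd b).app G := by
  refine CategoryTheory.Functor.ext (fun _ => rfl) (fun x y f => ?_)
  change _ = 𝟙 _ ≫ f.app _ ≫ 𝟙 _
  rw [Category.id_comp, Category.comp_id]
  change (x : interval ⥤ G).map (𝟙 _) ≫ f.app _ = _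
  exact (congrArg (fun t => t ≫ f.app (interval.pt b))
    ((x : interval ⥤ G).map_id (interval.pt b))).trans (Category.id_comp _)

variable {C : Type u} [Category.{v} C] [EnrichedOrdinaryCategory Grpd.{v, v} C]
  [TensoredCotensored Grpd.{v, v} C]

/-- The map `Fun(interval, Hom(B, A)) ⟶ Hom(B ⊗ interval, A)`. -/
def tenPathLift (B A : C) : grpdPath.obj (B ⟶[Grpd.{v, v}] A) ⟶
    (ten Grpd.{v, v} interval B ⟶[Grpd.{v, v}] A) :=
  (Equiv.ofBijective _ (ten_bijective interval B A _)).symm (pathEval _)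

lemma tenPathLift_eComp (B A : C) : (tenCoev Grpd.{v, v} interval B ⊗ₘ tenPathLift B A) ≫
    eComp Grpd.{v, v} B _ A = pathEval _ :=
  (Equiv.ofBijective _ (ten_bijective interval B A _)).apply_symm_apply (pathEval _)

/-- Under the universal property of the tensor both sides become evaluation of paths followed by
composition with `a`. -/
lemma tenPathLift_natural (B : C) {A A' : C} (a : A ⟶ A') :
    grpdPath.map (eHomWhiskerLeft Grpd.{v, v} B a) ≫ tenPathLift B A' =
      tenPathLift B A ≫ eHomWhiskerLeft Grpd.{v, v} _ a := by
  apply (ten_bijective interval B A' _).1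
  dsimp only
  rw [← Category.id_comp (tenCoev Grpd.{v, v} interval B), ← tensorHom_comp_tensorHom,
    id_tensorHom, Category.assoc, tenPathLift_eComp, pathEval_natural, ← tenPathLift_eComp,
    Category.assoc, eComp_eHomWhiskerLeft, ← id_tensorHom, tensorHom_comp_tensorHom_assoc,
    Category.comp_id, Category.id_comp]

lemma tenPathLift_pt (b : Bool) (B A : C) :
    tenPathLift B A ≫ eHomWhiskerRight Grpd.{v, v} (tenPt (intervalPt b) B) A =
      (grpdPathEnd b).app _ := by
  rw [eHomWhiskerRight, tenPt, Equiv.apply_symm_apply, leftUnitor_inv_naturality_assoc,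
    ← intervalPt_pathEval, ← tenPathLift_eComp, MonoidalCategory.tensorHom_def',
    comp_whiskerRight, Category.assoc, Category.assoc, whisker_exchange_assoc]

end Tensors

/-! ### Simplicial categories that derive from an enrichment over groupoids -/

section Derives

open SimplicialCategory

variable {C : Type u} [Category.{v} C] [SimplicialCategory C] [TensoredCotensored SSet.{v} C]
  [EnrichedOrdinaryCategory Grpd.{v, v} C] [TensoredCotensored Grpd.{v, v} C]

namespace DerivesFromGrpd

variable (h : DerivesFromGrpd C)

/-- Whiskering is composition with the point that names `f`, and `homIso` respects both composition
and these points; the comparison is made on each factor of the product. -/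
lemma whiskerRight_homIso_inv {A B : C} (f : A ⟶ B) (Z : C) :
    (h.homIso B Z).inv ≫ eHomWhiskerRight SSet.{v} f Z =
      grpdNerve.map (eHomWhiskerRight Grpd.{v, v} f Z) ≫ (h.homIso A Z).inv := by
  rw [eHomWhiskerRight_eq_lift, eHomWhiskerRight_eq_lift, Functor.map_comp, Category.assoc,
    h.eComp_comp, ← Category.assoc, ← Category.assoc, ← Category.assoc]
  congr 1
  refine CartesianMonoidalCategory.hom_ext _ _ ?_ ?_
  · rw [Category.assoc, Category.assoc, lift_fst, tensorHom_fst, Category.assoc,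
      CartesianMonoidalCategory.prodComparison_fst_assoc, ← Functor.map_comp_assoc,
      lift_fst, Functor.map_comp,
      Category.assoc, h.homEquiv_comp, ← Category.assoc, ← Category.assoc]
    congr 1
  · rw [Category.assoc, Category.assoc, lift_snd, tensorHom_snd, Category.assoc,
      CartesianMonoidalCategory.prodComparison_snd_assoc, ← Functor.map_comp_assoc,
      lift_snd, CategoryTheory.Functor.map_id,
      Category.id_comp, Category.comp_id]

lemma whiskerLeft_homIso_inv (Z : C) {A B : C} (f : A ⟶ B) :
    (h.homIso Z A).inv ≫ eHomWhiskerLeft SSet.{v} Z f =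
      grpdNerve.map (eHomWhiskerLeft Grpd.{v, v} Z f) ≫ (h.homIso Z B).inv := by
  rw [eHomWhiskerLeft_eq_lift, eHomWhiskerLeft_eq_lift, Functor.map_comp, Category.assoc,
    h.eComp_comp, ← Category.assoc, ← Category.assoc, ← Category.assoc]
  congr 1
  refine CartesianMonoidalCategory.hom_ext _ _ ?_ ?_
  · rw [Category.assoc, Category.assoc, lift_fst, tensorHom_fst, Category.assoc,
      CartesianMonoidalCategory.prodComparison_fst_assoc, ← Functor.map_comp_assoc,
      lift_fst, CategoryTheory.Functor.map_id,
      Category.id_comp, Category.comp_id]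
  · rw [Category.assoc, Category.assoc, lift_snd, tensorHom_snd, Category.assoc,
      CartesianMonoidalCategory.prodComparison_snd_assoc, ← Functor.map_comp_assoc,
      lift_snd, Functor.map_comp,
      Category.assoc, h.homEquiv_comp, ← Category.assoc, ← Category.assoc]
    congr 1

lemma whiskerRight_homIso_hom {A B : C} (f : A ⟶ B) (Z : C) :
    eHomWhiskerRight SSet.{v} f Z ≫ (h.homIso A Z).hom =
      (h.homIso B Z).hom ≫ grpdNerve.map (eHomWhiskerRight Grpd.{v, v} f Z) := by
  rw [← Iso.inv_comp_eq, ← Category.assoc, whiskerRight_homIso_inv, Category.assoc,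
    Iso.inv_hom_id, Category.comp_id]

lemma whiskerLeft_homIso_hom (Z : C) {A B : C} (f : A ⟶ B) :
    eHomWhiskerLeft SSet.{v} Z f ≫ (h.homIso Z B).hom =
      (h.homIso Z A).hom ≫ grpdNerve.map (eHomWhiskerLeft Grpd.{v, v} Z f) := by
  rw [← Iso.inv_comp_eq, ← Category.assoc, whiskerLeft_homIso_inv, Category.assoc,
    Iso.inv_hom_id, Category.comp_id]

/-- Maps `B ⟶ A^K` are maps from `K` to the nerve of the hom groupoid `Hom(B, A)`. -/
def powNerveEquiv (K : SSet.{v}) (A B : C) :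
    (B ⟶ pow SSet.{v} K A) ≃ (K ⟶ grpdNerve.obj (B ⟶[Grpd.{v, v}] A)) :=
  (powHomEquiv K A B).trans (Iso.homToEquiv (h.homIso B A))

lemma powNerveEquiv_apply {K : SSet.{v}} {A B : C} (f : B ⟶ pow SSet.{v} K A) :
    h.powNerveEquiv K A B f = powHomEquiv K A B f ≫ (h.homIso B A).hom := rfl

lemma powNerveEquiv_precomp {K : SSet.{v}} {A B B' : C} (b : B' ⟶ B) (f : B ⟶ pow SSet.{v} K A) :
    h.powNerveEquiv K A B' (b ≫ f) =
      h.powNerveEquiv K A B f ≫ grpdNerve.map (eHomWhiskerRight Grpd.{v, v} b A) := by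
  rw [powNerveEquiv_apply, powHomEquiv_precomp, Category.assoc, h.whiskerRight_homIso_hom,
    powNerveEquiv_apply, Category.assoc]

lemma powNerveEquiv_powMap {K K' : SSet.{v}} {A A' B : C} (κ : K' ⟶ K) (a : A ⟶ A')
    (f : B ⟶ pow SSet.{v} K A) :
    h.powNerveEquiv K' A' B (f ≫ powMap κ a) =
      κ ≫ h.powNerveEquiv K A B f ≫ grpdNerve.map (eHomWhiskerLeft Grpd.{v, v} B a) := by
  rw [powNerveEquiv_apply, powHomEquiv_powMap, Category.assoc, Category.assoc,
    h.whiskerLeft_homIso_hom, powNerveEquiv_apply, Category.assoc]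

/-- Hom groupoids represent the cotensors of a simplicial category whose structure derives from an
enrichment over groupoids. -/
def repr : GrpdRepr (powFunctor SSet.{v} C) where
  hom := eHomFunctor Grpd.{v, v} C
  powEquiv := h.powNerveEquiv
  powEquiv_precomp := h.powNerveEquiv_precomp
  powEquiv_map {K A A' B} a f :=
    (h.powNerveEquiv_powMap (𝟙 K) a f).trans (Category.id_comp _)
  powEquiv_weight {K K' A B} κ f := by
    refine (h.powNerveEquiv_powMap κ (𝟙 A) f).trans ?_
    rw [eHomWhiskerLeft_id, CategoryTheory.Functor.map_id, Category.comp_id]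
    rfl
  cyl B := ten Grpd.{v, v} interval B
  ι b B := tenPt (intervalPt b) B
  cylLift B :=
    { app A := tenPathLift B A
      naturality _ _ a := tenPathLift_natural B a }
  cylLift_ι b B A := tenPathLift_pt b B A

end DerivesFromGrpd

end Derives

/-! ### The interval `Δ[1]` -/

section Vertices

/-- The vertex of `Δ[1]` that is the image of the `i`-th coface. -/
def simplexPt (i : Fin 2) : 𝟙_ SSet.{v} ⟶ Δ[1] :=
  SSet.stdSimplex.isTerminalObj₀.from _ ≫ SSet.stdSimplex.δ i

lemma toUnit_simplexPt (i : Fin 2) : toUnit Δ[0] ≫ simplexPt.{v} i = SSet.stdSimplex.δ i := by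
  rw [simplexPt, ← Category.assoc, SSet.stdSimplex.isTerminalObj₀.hom_ext
    (toUnit Δ[0] ≫ SSet.stdSimplex.isTerminalObj₀.from _) (𝟙 _), Category.id_comp]

/-- This fixes the orientation: `simplexPt 1` is the source vertex of `Δ[1]` and `simplexPt 0` the
target. -/
lemma unitHomEquiv_simplexPt_comp (i : Fin 2) {S : SSet.{v}} (e : S _⦋1⦌) :
    S.unitHomEquiv (simplexPt i ≫ SSet.yonedaEquiv.symm e) = S.δ i e := by
  change SSet.yonedaEquiv (toUnit Δ[0] ≫ simplexPt i ≫ SSet.yonedaEquiv.symm e) = _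
  rw [← Category.assoc, toUnit_simplexPt]
  change SSet.yonedaEquiv (SSet.stdSimplex.map (SimplexCategory.δ i) ≫ _) = _
  rw [SSet.yonedaEquiv_symm_naturality_left, Equiv.apply_symm_apply]
  rfl

/-- A horn in `Δ[1]` is a single vertex, so horn filling in this dimension is path lifting. -/
lemma toUnit_simplexPt_eq_horn_ι {i j : Fin 2} (hij : j ≠ i) :
    toUnit _ ≫ simplexPt.{v} j = (Λ[1, i] : (Δ[1] : SSet.{v}).Subcomplex).ι := by
  refine SSet.horn.hom_ext' fun k hk => ?_
  obtain rfl : k = j := by omega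
  rw [SSet.horn.ι_ι, ← toUnit_simplexPt, ← Category.assoc]
  rfl

/-- Lifting of paths along a Kan fibration. -/
lemma exists_lift_of_J_rlp {S T : SSet.{v}} (φ : S ⟶ T) (hφ : SSet.modelCategoryQuillen.J.rlp φ)
    (j : Fin 2) (s : 𝟙_ SSet.{v} ⟶ S) (t : Δ[1] ⟶ T) (h : simplexPt j ≫ t = s ≫ φ) :
    ∃ l : Δ[1] ⟶ S, simplexPt j ≫ l = s ∧ l ≫ φ = t := by
  obtain ⟨i, hij⟩ : ∃ i : Fin 2, j ≠ i := ⟨j.rev, by fin_cases j <;> decide⟩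
  have := hφ _ (SSet.modelCategoryQuillen.horn_ι_mem_J 1 i)
  have sq : CommSq (toUnit _ ≫ s) (Λ[1, i] : (Δ[1] : SSet.{v}).Subcomplex).ι φ t :=
    ⟨by rw [← toUnit_simplexPt_eq_horn_ι hij, Category.assoc, Category.assoc, h]⟩
  refine ⟨sq.lift, ?_, sq.fac_right⟩
  have h₁ : simplexPt.{v} j = (SSet.stdSimplex.isTerminalObj₀.from _ ≫ SSet.horn.ι i j hij) ≫
      (Λ[1, i] : (Δ[1] : SSet.{v}).Subcomplex).ι := by
    rw [Category.assoc, SSet.horn.ι_ι]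
    rfl
  rw [h₁, Category.assoc, sq.fac_left, ← Category.assoc, toUnit_unique (_ ≫ toUnit _) (𝟙 _),
    Category.id_comp]

end Vertices

/-! ### Simplicial homotopies -/

section SimplicialHomotopies

open SimplicialCategory

variable {C : Type u} [Category.{v} C] [SimplicialCategory C]

lemma homEquiv'_precomp {A B Z : C} (f : A ⟶ B) (g : B ⟶ Z) :
    homEquiv' A Z (f ≫ g) = (eHomWhiskerRight SSet.{v} f Z).app _ (homEquiv' B Z g) := by
  change (SSet.unitHomEquiv _) (eHomEquiv SSet.{v} (f ≫ g)) = _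
  rw [← eHomEquiv_whiskerRight]
  rfl

lemma SimplicialHomotopic.refl {A B : C} (f : A ⟶ B) : SimplicialHomotopic f f := by
  refine ⟨(sHom A B).σ 0 (homEquiv' A B f), ?_, ?_⟩
  · exact ConcreteCategory.congr_hom ((sHom A B).δ_comp_σ_succ (i := 0)) _
  · exact ConcreteCategory.congr_hom ((sHom A B).δ_comp_σ_self (i := 0)) _

lemma SimplicialHomotopic.precomp {A B Z : C} (p : A ⟶ B) {f g : B ⟶ Z}
    (h : SimplicialHomotopic f g) : SimplicialHomotopic (p ≫ f) (p ≫ g) := by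
  obtain ⟨e, h₁, h₀⟩ := h
  refine ⟨(eHomWhiskerRight SSet.{v} p Z).app _ e, ?_, ?_⟩
  · rw [homEquiv'_precomp, ← h₁]
    exact (ConcreteCategory.congr_hom
      (SimplicialObject.δ_naturality (eHomWhiskerRight SSet.{v} p Z) 1) e).symm
  · rw [homEquiv'_precomp, ← h₀]
    exact (ConcreteCategory.congr_hom
      (SimplicialObject.δ_naturality (eHomWhiskerRight SSet.{v} p Z) 0) e).symm

/-- A map from the cylinder of a groupoid enrichment is a simplicial homotopy. -/
lemma DerivesFromGrpd.simplicialHomotopic [TensoredCotensored SSet.{v} C]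
    [EnrichedOrdinaryCategory Grpd.{v, v} C] [TensoredCotensored Grpd.{v, v} C]
    (h : DerivesFromGrpd C) {B Z : C} (H : ten Grpd.{v, v} interval B ⟶ Z) :
    SimplicialHomotopic (tenPt (intervalPt false) B ≫ H) (tenPt (intervalPt true) B ≫ H) := by
  let γ := tenHomEquiv interval B Z H
  let φ : grpdNerve.obj interval ⟶ sHom B Z := grpdNerve.map γ ≫ (h.homIso B Z).inv
  let pt : (grpdNerve.obj (𝟙_ Grpd.{v, v})) _⦋0⦌ :=
    ComposableArrows.mk₀ (⟨⟨⟩⟩ : Discrete PUnit.{v + 1})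
  have key (b : Bool) : homEquiv' B Z (tenPt (intervalPt b) B ≫ H) =
      φ.app _ ((grpdNerve.map (intervalPt b)).app _ pt) := by
    -- Compatibility of `homIso` with underlying morphisms identifies the ends of the cylinder map
    -- with the images of the end vertices of the interval.
    have := ConcreteCategory.congr_hom (NatTrans.congr_app
      (h.homEquiv_comp (tenPt (intervalPt b) B ≫ H)) (op ⦋0⦌)) pt
    rw [eHomEquiv_tenPt_comp] at this
    exact this.symm
  let e : (grpdNerve.obj interval.{v}) _⦋1⦌ := ComposableArrows.mk₁ interval.arrow.{v}
  refine ⟨φ.app _ e, ?_, ?_⟩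
  · rw [key]
    refine (ConcreteCategory.congr_hom (SimplicialObject.δ_naturality φ 1) e).symm.trans ?_
    exact congrArg (φ.app (op ⦋0⦌)) (ComposableArrows.ext₀ rfl)
  · rw [key]
    refine (ConcreteCategory.congr_hom (SimplicialObject.δ_naturality φ 0) e).symm.trans ?_
    exact congrArg (φ.app (op ⦋0⦌)) (ComposableArrows.ext₀ rfl)

lemma SimplicialHomotopic.exists_cylinder [TensoredCotensored SSet.{v} C] {A B : C}
    {f g : A ⟶ B} (h : SimplicialHomotopic f g) :
    ∃ K : ten SSet.{v} Δ[1] A ⟶ B,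
      tenPt (simplexPt 1) A ≫ K = f ∧ tenPt (simplexPt 0) A ≫ K = g := by
  obtain ⟨e, h₁, h₀⟩ := h
  refine ⟨(tenHomEquiv Δ[1] A B).symm (SSet.yonedaEquiv.symm e), ?_, ?_⟩
  · apply (homEquiv' A B).injective
    rw [← h₁, ← unitHomEquiv_simplexPt_comp]
    change SSet.unitHomEquiv _ (eHomEquiv SSet.{v} _) = _
    rw [eHomEquiv_tenPt_comp, Equiv.apply_symm_apply]
  · apply (homEquiv' A B).injective
    rw [← h₀, ← unitHomEquiv_simplexPt_comp]
    change SSet.unitHomEquiv _ (eHomEquiv SSet.{v} _) = _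
    rw [eHomEquiv_tenPt_comp, Equiv.apply_symm_apply]

end SimplicialHomotopies

/-! ### Homotopic maps in a simplicial model category -/

section ModelCategory

open SimplicialCategory

variable {C : Type u} [Category.{v} C] [ModelCategory C] [SimplicialCategory C]
  [TensoredCotensored SSet.{v} C]

/-- By the cotensor these maps are maps from the initial object to `X^K`. -/
lemma subsingleton_hom_sHom_initial (K : SSet.{v}) (X : C) :
    Subsingleton (K ⟶ sHom (⊥_ C) X) :=
  (powHomEquiv K X (⊥_ C)).symm.subsingleton

variable [IsSimplicialModelCategory C]

/-- The ends of the cylinder of a cofibrant object are trivial cofibrations. -/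
lemma weakEquivalence_tenPt (A : C) [IsCofibrant A] (j : Fin 2) :
    WeakEquivalence (tenPt (simplexPt.{v} j) A) := by
  suffices trivialCofibrations C (tenPt (simplexPt.{v} j) A) from
    (mem_trivialCofibrations_iff _).1 this |>.2
  -- Trivial cofibrations are detected by lifting against fibrations.
  rw [← fibrations_llp]
  intro X Y q hq
  have : Fibration q := ⟨hq⟩
  refine ⟨fun {u w} sq => ?_⟩
  -- SM7 for the cofibration from the initial object: the factors `Hom(⊥, X)` and `Hom(⊥, Y)` carry
  -- no information, so this is the Kan fibration property of `Hom(A, X) ⟶ Hom(A, Y)`. The required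
  -- lift is a path in `Hom(A, X)` with the end `u` prescribed, over the path that corresponds to
  -- `w`.
  have hJ := IsSimplicialModelCategory.fibration (initial.to A) q
  have hsub (K : SSet.{v}) := subsingleton_hom_sHom_initial K X
  have hsub' (K : SSet.{v}) := subsingleton_hom_sHom_initial K Y
  obtain ⟨l, hl, hl'⟩ := exists_lift_of_J_rlp _ hJ j (eHomEquiv SSet.{v} u)
    (pullback.lift ((powHomEquiv _ _ _) (initial.to (pow SSet.{v} Δ[1] X)))
      (tenHomEquiv _ _ _ w) (Subsingleton.elim _ _)) (by
        apply pullback.hom_ext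
        · exact Subsingleton.elim _ _
        · rw [Category.assoc, Category.assoc, pullback.lift_snd, pullbackHom, pullback.lift_snd,
            ← eHomEquiv_tenPt_comp, ← sq.w, eHomEquiv_whiskerLeft])
  refine ⟨⟨(tenHomEquiv Δ[1] A X).symm l, ?_, ?_⟩⟩
  · apply (eHomEquiv SSet.{v}).injective
    rw [eHomEquiv_tenPt_comp, Equiv.apply_symm_apply, hl]
  · apply (tenHomEquiv Δ[1] A Y).injective
    have := (Category.assoc _ _ _).symm.trans (congrArg (fun t => t ≫ pullback.snd _ _) hl')
    rw [pullbackHom, pullback.lift_snd, pullback.lift_snd] at this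
    rw [tenHomEquiv_postcomp, Equiv.apply_symm_apply, this]

/-- A map that is simplicially homotopic to the identity is a weak equivalence. -/
lemma weakEquivalence_of_simplicialHomotopic_id {A : C} {f : A ⟶ A}
    (h : SimplicialHomotopic f (𝟙 A)) : WeakEquivalence f := by
  -- `A` need not be cofibrant, so the homotopy is restricted along a cofibrant replacement. There
  -- both ends of the cylinder are weak equivalences, and two-out-of-three passes from `F.p` to the
  -- homotopy `K`, then to `F.p ≫ f` and to `f`.
  obtain ⟨F⟩ : Nonempty (MorphismProperty.MapFactorizationData (cofibrations C)
    (trivialFibrations C) (initial.to A)) := ⟨MorphismProperty.factorizationData _ _ _⟩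
  have hp : WeakEquivalence F.p := ⟨F.hp.2⟩
  have hQ : IsCofibrant F.Z := by
    have : Cofibration F.i := ⟨F.hi⟩
    rwa [isCofibrant_iff, Subsingleton.elim (initial.to F.Z) F.i]
  obtain ⟨K, hK₁, hK₀⟩ := (h.precomp F.p).exists_cylinder
  rw [Category.comp_id] at hK₀
  have := weakEquivalence_tenPt F.Z 0
  have := weakEquivalence_tenPt F.Z 1
  have : WeakEquivalence K := weakEquivalence_of_precomp_of_fac hK₀
  have : WeakEquivalence (F.p ≫ f) := by
    rw [← hK₁]
    infer_instance
  exact weakEquivalence_of_precomp F.p f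

/-- A map with a retraction which is a homotopy inverse is a weak equivalence. -/
lemma weakEquivalence_of_retraction {A B : C} {f : A ⟶ B} {g : B ⟶ A} (hfg : f ≫ g = 𝟙 A)
    (h : SimplicialHomotopic (g ≫ f) (𝟙 B)) : WeakEquivalence f := by
  have hgf := weakEquivalence_of_simplicialHomotopic_id h
  -- Since `f ≫ g` is strictly the identity, `f` is a retract of `g ≫ f` with fixed target `B`.
  have r : RetractArrow f (g ≫ f) :=
    { i := Arrow.homMk f (𝟙 B) (by simp [reassoc_of% hfg])
      r := Arrow.homMk g (𝟙 B) (by simp)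
      retract := by ext <;> simp [hfg] }
  exact ⟨(weakEquivalences C).of_retract r hgf.mem⟩

end ModelCategory

/-! ### Assembly of the homotopy equivalence -/

section Main

lemma isEquivalence_of_isIso {G G' : Grpd.{v, v}} (F : G ⟶ G') [IsIso F] :
    Functor.IsEquivalence F :=
  Functor.IsEquivalence.mk' (inv F) (eqToIso (IsIso.hom_inv_id F).symm)
    (eqToIso (IsIso.inv_hom_id F))

variable {C : Type u} [Category.{v} C] [ModelCategory C] [HasProducts.{0} C]
  [SimplicialCategory C] [TensoredCotensored SSet.{v} C]
  [EnrichedOrdinaryCategory Grpd.{v, v} C] [TensoredCotensored Grpd.{v, v} C]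

lemma DerivesFromGrpd.ofHolim_toHolim_homotopic (h : DerivesFromGrpd C) (X : SimplexCategory ⥤ C) :
    SimplicialHomotopic ((ofHolim h.repr).app X ≫ (toHolim h.repr).app X) (𝟙 _) := by
  obtain ⟨H, h₀, h₁⟩ := exists_cyl_ofHolim_toHolim h.repr X
  rw [← h₀, ← h₁]
  exact h.simplicialHomotopic H

lemma DerivesFromGrpd.isSimplicialHomotopyEquiv_toHolim (h : DerivesFromGrpd C)
    (X : SimplexCategory ⥤ C) : IsSimplicialHomotopyEquiv ((toHolim h.repr).app X) := by
  refine ⟨(ofHolim h.repr).app X, ?_, h.ofHolim_toHolim_homotopic X⟩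
  rw [toHolim_ofHolim]
  exact .refl _

end Main

end

end HolimGrpd

theorem mainTheorem2 :
    -- a simplicial model category whose simplicial structure derives from a groupoid enrichment
    (∀ (C : Type u) [Category.{v} C] [ModelCategory C] [HasProducts.{0} C]
        [SimplicialCategory C] [TensoredCotensored SSet.{v} C] [IsSimplicialModelCategory C]
        [EnrichedOrdinaryCategory Grpd.{v, v} C] [TensoredCotensored Grpd.{v, v} C]
        (_ : DerivesFromGrpd C),
      -- the equalizer is naturally equivalent to the homotopy limit
      (∃ τ : truncTot (powFunctor SSet.{v} C) 2 1 ⟶ holim (powFunctor SSet.{v} C),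
        ∀ X : SimplexCategory ⥤ C, (∀ n, IsFibrant (X.obj n)) →
          WeakEquivalence (τ.app X) ∧ IsSimplicialHomotopyEquiv (τ.app X)) ∧
      -- and it is `Tot_2`
      (∃ e : truncTot (powFunctor SSet.{v} C) 2 1 ≅ truncTot (powFunctor SSet.{v} C) 2 2,
        ∀ X : SimplexCategory ⥤ C, e.hom.app X ≫ truncTotι (powFunctor SSet.{v} C) 2 2 X =
          truncTotι (powFunctor SSet.{v} C) 2 1 X)) ∧
    -- for cosimplicial groupoids it is the descent groupoid
    Nonempty (descFunctor.{v} ≅ truncTot grpdPow.{v} 2 1) ∧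
    Nonempty (descFunctor.{v} ≅ truncTot grpdPow.{v} 2 2) ∧
    (∃ τ : descFunctor.{v} ⟶ holim grpdPow.{v}, ∀ X : SimplexCategory ⥤ Grpd.{v, v},
      Functor.IsEquivalence (τ.app X)) := by
  refine ⟨fun C _ _ _ _ _ _ _ _ h => ⟨⟨toHolim h.repr, fun X _ => ⟨?_, ?_⟩⟩,
    truncTotIso h.repr le_rfl le_rfl le_rfl one_le_two,
    truncTotIso_hom_ι h.repr le_rfl le_rfl one_le_two⟩,
    ⟨descIso le_rfl le_rfl⟩, ⟨descIso le_rfl one_le_two⟩,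
    (descIso le_rfl le_rfl).hom ≫ toHolim grpdPowRepr, fun X => ?_⟩
  · exact weakEquivalence_of_retraction (toHolim_ofHolim h.repr X) (h.ofHolim_toHolim_homotopic X)
  · exact h.isSimplicialHomotopyEquiv_toHolim X
  · have := isEquivalence_toHolim X
    have := isEquivalence_of_isIso ((descIso.{v} le_rfl le_rfl).hom.app X)
    exact Functor.isEquivalence_trans ((descIso.{v} le_rfl le_rfl).hom.app X)
      ((toHolim grpdPowRepr).app X)
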